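/- All graphs are finite and simple. Let $H$ be a fixed nonempty graph without isolated vertices, let $S$ be a fixed graph with at least one edge, and put $v=|V(H)|$. A copy of $H$ in a complete graph is a (not necessarily induced) subgraph isomorphic to $H$. For an integer $m$ between $0$ and the number of copies of $H$ in $K_n$, the uniform random motif graph $\bar G(H,n,m)$ is the graph on the $n$ vertices of $K_n$ that is the union of $m$ copies of $H$ in $K_n$ chosen uniformly at random without replacement. Fix an infinite vertex set $V$ and regard $S$ as a graph on a subset of $V$. A covering of $S$ by $H$ is a finite set $C$ of copies of $H$ on subsets of $V$ such that $S\subseteq\bigcup_{K\in C}K$, and $S\not\subseteq\bigcup_{K\in C\setminus\{L\}}K$ for every $L\in C$. For a covering $C$ let \[ \gamma(C)=\min_{\emptyset\ne D\subseteq C}\frac{\bigl|V\bigl(\bigcup_{K\in D}K\bigr)\bigr|}{|D|}, \qquad\text{and let}\qquad \bar\gamma=\bar\gamma(S,H)=\max_{C}\gamma(C), \] where the maximum is over all coverings $C$ of $S$ by $H$. (Up to isomorphism there are only finitely many coverings.) Let $m=m(n)$ be a sequence of integers such that, for all large $n$, $0\le m(n)\le$ the number of copies of $H$ in $K_n$.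 Then \[ \lim_{n\to\infty}\Pr\bigl[S\subseteq\bar G(H,n,m)\bigr]=\begin{cases}0 & \text{if } m\ll n^{v-\bar\gamma},\\ 1 & \text{if } m\gg n^{v-\bar\gamma},\end{cases} \] where $S\subseteq G$ means that $G$ has a (not necessarily induced) subgraph isomorphic to $S$, $f\ll g$ means $f=o(g)$ as $n\to\infty$, and $f\gg g$ means $g=o(f)$. -/

import Mathlib

open Filter Topology Asymptotics
open scoped SimpleGraph

namespace MotifGraph

/-- `K` is a copy of `H` in `G`: a (not necessarily induced) subgraph of `G` isomorphic to `H`. -/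
def IsCopy {W V : Type*} (H : SimpleGraph W) {G : SimpleGraph V} (K : G.Subgraph) : Prop :=
  Nonempty (H ≃g K.coe)

/-- The families of exactly `m` distinct copies of `H` in the complete graph on `n` vertices. -/
def copyFamilies {W : Type*} (H : SimpleGraph W) (n m : ℕ) :
    Set (Set (⊤ : SimpleGraph (Fin n)).Subgraph) :=
  {F | (∀ K ∈ F, IsCopy H K) ∧ F.ncard = m}

/-- The law of the uniform random motif graph: the union, as a graph on all `n` vertices, of `m`
copies of `H` in the complete graph on `n` vertices that are chosen uniformly at random without
replacement. It is a probability measure as soon as there are at least `m` copies. -/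
noncomputable def uniformMotifGraph {W : Type*} (H : SimpleGraph W) (n m : ℕ) :
    MeasureTheory.Measure (SimpleGraph (Fin n)) :=
  (ProbabilityTheory.uniformOn (copyFamilies H n m)).map fun F => (sSup F).spanningCoe

/-- `C` is a covering of the graph `T` by copies of `H` (all inside the complete graph on `V`):
a finite set of copies of `H` whose union contains `T`, whereas `T` is not contained in the union
of the copies that remain when one of them is left out. -/
structure IsCovering {W V : Type*} (H : SimpleGraph W) (T : (⊤ : SimpleGraph V).Subgraph)
    (C : Set (⊤ : SimpleGraph V).Subgraph) : Prop where
  finite : C.Finite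
  isCopy : ∀ K ∈ C, IsCopy H K
  covers : T ≤ sSup C
  minimal : ∀ K ∈ C, ¬ T ≤ sSup (C \ {K})

/-- The minimum of `a' / b'` over the nonempty subsets `D` of `C`, where `b'` is the number of
members of `D` and `a'` is the number of vertices of their union. -/
noncomputable def gamma {V : Type*} (C : Set (⊤ : SimpleGraph V).Subgraph) : ℝ :=
  sInf {r | ∃ D ⊆ C, D.Nonempty ∧ r = ((sSup D).verts.ncard : ℝ) / (D.ncard : ℝ)}

/-- The maximum of `gamma C` over all coverings `C` of (a copy of) `S` by copies of `H`. The
infinite vertex supply `ℕ` has room for every configuration; up to isomorphism there are finitely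
many of them, so that the supremum is a maximum. -/
noncomputable def gammaBar {U W : Type*} (S : SimpleGraph U) (H : SimpleGraph W) : ℝ :=
  sSup {r | ∃ T : (⊤ : SimpleGraph ℕ).Subgraph, IsCopy S T ∧
    ∃ C : Set (⊤ : SimpleGraph ℕ).Subgraph, IsCovering H T C ∧ r = gamma C}

end MotifGraph

/-! The proof is a first-moment and a second-moment argument. Let $N$ be the number of copies of $H$
in $K_n$; it has order $n^v$. Put $p=m/N$. A given set of $d$ copies is chosen with probability at
most $p^d$, and at least $(p/2)^d$ once $2d\le m$.

Below the threshold, any family whose union contains $S$ contains a nonempty subfamily $D$ of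
bounded size with at most $\bar\gamma|D|$ vertices (`exists_sparse_subfamily`): extract a covering
and take the subset attaining its $\gamma$. There are $O(n^{\bar\gamma d})$ such subfamilies of size
$d$ (`card_families_le`), so the union bound gives $\sum_d O((n^{\bar\gamma}p)^d)$, and
$n^{\bar\gamma}p$ is of order $m/n^{v-\bar\gamma}$.

Above the threshold, fix a covering $C$ with $\gamma(C)=\bar\gamma$ on $c$ points and consider all
its images under injections into the $n$ vertices. If the chosen family contains one of these
images, then $S$ appears. Chebyshev's inequality (`card_forall_not_subset_le`) bounds the
probability that none is contained. Pairs of disjoint images are negatively correlated, so only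
pairs sharing copies count. Those sharing the image of $D\subseteq C$ contribute, relative to the
squared mean, $O((n^{|V(D)|}p^{|D|})^{-1})$ (`sum_inclusionProb_le`, `ratio_le`). Since
$|V(D)|\ge\bar\gamma|D|$, this is $O((n^{v-\bar\gamma}/m)^{|D|})$, which tends to $0$. -/

namespace MotifGraph

/-! ### Transport of subgraphs and coverings along injections -/

section Relabel

variable {V V' W : Type*}

/-- The image of a subgraph of the complete graph under an injection of the vertex set. -/
def relabel (f : V ↪ V') (K : (⊤ : SimpleGraph V).Subgraph) : (⊤ : SimpleGraph V').Subgraph :=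
  K.map (SimpleGraph.Embedding.completeGraph f).toHom

@[simp]
theorem relabel_verts (f : V ↪ V') (K : (⊤ : SimpleGraph V).Subgraph) :
    (relabel f K).verts = f '' K.verts := rfl

@[simp]
theorem relabel_adj (f : V ↪ V') (K : (⊤ : SimpleGraph V).Subgraph) {x y : V'} :
    (relabel f K).Adj x y ↔ ∃ a b, K.Adj a b ∧ f a = x ∧ f b = y := Iff.rfl

theorem relabel_adj_apply (f : V ↪ V') (K : (⊤ : SimpleGraph V).Subgraph) {a b : V} :
    (relabel f K).Adj (f a) (f b) ↔ K.Adj a b := by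
  simp

theorem relabel_le_relabel (f : V ↪ V') {K L : (⊤ : SimpleGraph V).Subgraph} :
    relabel f K ≤ relabel f L ↔ K ≤ L := by
  refine ⟨fun h => ⟨fun a ha => ?_, fun a b hab => ?_⟩, fun h => SimpleGraph.Subgraph.map_mono h⟩
  · obtain ⟨b, hb, hba⟩ := h.1 (Set.mem_image_of_mem f ha)
    rwa [← f.injective hba]
  · exact (relabel_adj_apply f L).1 (h.2 ((relabel_adj_apply f K).2 hab))

theorem relabel_injective (f : V ↪ V') : Function.Injective (relabel f) := fun _ _ h =>
  le_antisymm ((relabel_le_relabel f).1 h.le) ((relabel_le_relabel f).1 h.ge)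

theorem relabel_sSup (f : V ↪ V') (D : Set (⊤ : SimpleGraph V).Subgraph) :
    relabel f (sSup D) = sSup (relabel f '' D) := by
  apply SimpleGraph.Subgraph.ext
  · simp [Set.image_iUnion]
  · ext x y
    simp only [relabel_adj, SimpleGraph.Subgraph.sSup_adj, Set.exists_mem_image]
    constructor
    · rintro ⟨a, b, ⟨K, hK, h⟩, h1, h2⟩
      exact ⟨K, hK, a, b, h, h1, h2⟩
    · rintro ⟨K, hK, a, b, h, h1, h2⟩
      exact ⟨a, b, ⟨K, hK, h⟩, h1, h2⟩

theorem isCopy_relabel {H : SimpleGraph W} (f : V ↪ V') {K : (⊤ : SimpleGraph V).Subgraph} :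
    IsCopy H (relabel f K) ↔ IsCopy H K := by
  have e : K.coe ≃g (relabel f K).coe :=
    (SimpleGraph.Embedding.completeGraph f).toCopy.isoSubgraphMap K
  exact ⟨fun ⟨g⟩ => ⟨g.trans e.symm⟩, fun ⟨g⟩ => ⟨g.trans e⟩⟩

theorem exists_relabel_eq (f : V ↪ V') {K : (⊤ : SimpleGraph V').Subgraph}
    (hK : K.verts ⊆ Set.range f) : ∃ L, relabel f L = K := by
  refine ⟨K.comap (SimpleGraph.Embedding.completeGraph f).toHom, ?_⟩
  apply SimpleGraph.Subgraph.ext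
  · exact Set.image_preimage_eq_of_subset hK
  · ext x y
    constructor
    · rintro ⟨a, b, h, rfl, rfl⟩
      exact h.2
    · intro h
      obtain ⟨a, rfl⟩ := hK (K.edge_vert h)
      obtain ⟨b, rfl⟩ := hK (K.edge_vert h.symm)
      refine ⟨a, b, ⟨?_, h⟩, rfl, rfl⟩
      simpa using h.ne

theorem ncard_verts_sSup_relabel (f : V ↪ V') (D : Set (⊤ : SimpleGraph V).Subgraph) :
    (sSup (relabel f '' D)).verts.ncard = (sSup D).verts.ncard := by
  rw [← relabel_sSup, relabel_verts, Set.ncard_image_of_injective _ f.injective]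

theorem gamma_relabel (f : V ↪ V') (C : Set (⊤ : SimpleGraph V).Subgraph) :
    gamma (relabel f '' C) = gamma C := by
  unfold gamma
  congr 1
  ext r
  constructor
  · rintro ⟨D, hD, hne, rfl⟩
    obtain ⟨D, hDC, rfl⟩ := Set.subset_image_iff.1 hD
    refine ⟨D, hDC, hne.of_image, ?_⟩
    rw [ncard_verts_sSup_relabel, Set.ncard_image_of_injective _ (relabel_injective f)]
  · rintro ⟨D, hD, hne, rfl⟩
    refine ⟨relabel f '' D, Set.image_mono hD, hne.image _, ?_⟩
    rw [ncard_verts_sSup_relabel, Set.ncard_image_of_injective _ (relabel_injective f)]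

theorem IsCovering.relabel {H : SimpleGraph W} (f : V ↪ V') {T : (⊤ : SimpleGraph V).Subgraph}
    {C : Set (⊤ : SimpleGraph V).Subgraph} (h : IsCovering H T C) :
    IsCovering H (relabel f T) (relabel f '' C) where
  finite := h.finite.image _
  isCopy := by
    rintro _ ⟨K, hK, rfl⟩
    exact (isCopy_relabel f).2 (h.isCopy K hK)
  covers := by
    rw [← relabel_sSup, relabel_le_relabel]
    exact h.covers
  minimal := by
    rintro _ ⟨K, hK, rfl⟩
    rw [← Set.image_singleton, ← Set.image_sdiff (relabel_injective f), ← relabel_sSup,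
      relabel_le_relabel]
    exact h.minimal K hK

end Relabel

/-! ### Copies of H as images of injections -/

section Copies

variable {V W : Type*} {H : SimpleGraph W}

/-- The copy of `H` placed on the range of an injection `W ↪ V`. -/
def placed (H : SimpleGraph W) (f : W ↪ V) : (⊤ : SimpleGraph V).Subgraph :=
  relabel f (SimpleGraph.toSubgraph H le_top)

@[simp]
theorem placed_verts (f : W ↪ V) : (placed H f).verts = Set.range f := by
  simp [placed, SimpleGraph.toSubgraph]

theorem placed_adj (f : W ↪ V) {x y : V} :
    (placed H f).Adj x y ↔ ∃ a b, H.Adj a b ∧ f a = x ∧ f b = y := Iff.rfl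

theorem isCopy_placed (f : W ↪ V) : IsCopy H (placed H f) := by
  refine (isCopy_relabel f).2 ⟨⟨(Equiv.Set.univ W).symm, ?_⟩⟩
  intro a b
  rfl

/-- Parametrizing copies by injections of `W` is what makes them countable. -/
theorem IsCopy.exists_placed {K : (⊤ : SimpleGraph V).Subgraph} (h : IsCopy H K) :
    ∃ f : W ↪ V, placed H f = K := by
  obtain ⟨e⟩ := h
  refine ⟨e.toEquiv.toEmbedding.trans (Function.Embedding.subtype _), ?_⟩
  apply SimpleGraph.Subgraph.ext
  · rw [placed_verts]
    ext x
    constructor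
    · rintro ⟨w, rfl⟩
      exact (e w).2
    · intro hx
      exact ⟨e.symm ⟨x, hx⟩, by simp⟩
  · ext x y
    rw [placed_adj]
    constructor
    · rintro ⟨a, b, h, rfl, rfl⟩
      exact e.map_adj_iff.2 h
    · intro h
      refine ⟨e.symm ⟨x, K.edge_vert h⟩, e.symm ⟨y, K.edge_vert h.symm⟩, ?_, by simp, by simp⟩
      rw [e.symm.map_adj_iff]
      exact h

theorem IsCopy.ncard_verts {K : (⊤ : SimpleGraph V).Subgraph} (h : IsCopy H K) :
    K.verts.ncard = Nat.card W := by
  obtain ⟨e⟩ := h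
  exact (Nat.card_congr e.toEquiv).symm

theorem IsCopy.finite_verts [Finite W] {K : (⊤ : SimpleGraph V).Subgraph} (h : IsCopy H K) :
    K.verts.Finite := by
  obtain ⟨f, rfl⟩ := h.exists_placed
  simpa using Set.finite_range f

theorem finite_verts_sSup [Finite W] {D : Set (⊤ : SimpleGraph V).Subgraph} (hD : D.Finite)
    (h : ∀ K ∈ D, IsCopy H K) : (sSup D).verts.Finite := by
  rw [SimpleGraph.Subgraph.verts_sSup]
  exact hD.biUnion fun K hK => (h K hK).finite_verts

theorem IsCopy.isContained_spanningCoe {U : Type*} {S : SimpleGraph U}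
    {T L : (⊤ : SimpleGraph V).Subgraph} (h : IsCopy S T) (hL : T ≤ L) : S ⊑ L.spanningCoe := by
  obtain ⟨f, rfl⟩ := h.exists_placed
  exact ⟨⟨⟨f, fun {a b} hab => hL.2 ((placed_adj f).2 ⟨a, b, hab, rfl, rfl⟩)⟩, f.injective⟩⟩

end Copies

/-! ### Coverings, the parameter γ, and sparse subfamilies -/

section Covering

variable {U V W : Type*} {H : SimpleGraph W} {S : SimpleGraph U}

/-- An inclusion-minimal subfamily that still covers `T` loses the covering property when any member
is removed. -/
theorem exists_isCovering_subset {T : (⊤ : SimpleGraph V).Subgraph}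
    {F : Set (⊤ : SimpleGraph V).Subgraph} (hF : F.Finite) (hcopy : ∀ K ∈ F, IsCopy H K)
    (hT : T ≤ sSup F) : ∃ C ⊆ F, IsCovering H T C := by
  have hfin : {C | C ⊆ F ∧ T ≤ sSup C}.Finite := hF.finite_subsets.subset fun C hC => hC.1
  obtain ⟨C, hCF, hC⟩ := hfin.exists_le_minimal (a := F) ⟨subset_rfl, hT⟩
  refine ⟨C, hCF, hF.subset hCF, fun K hK => hcopy K (hCF hK), hC.prop.2, fun K hK hle => ?_⟩
  have := hC.le_of_le (y := C \ {K}) ⟨Set.sdiff_subset.trans hCF, hle⟩ Set.sdiff_subset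
  exact (this hK).2 rfl

/-- By minimality each member of `C` has a private vertex or ordered pair of vertices of `S` that it
alone covers, and distinct members have distinct private witnesses. -/
theorem IsCovering.ncard_le [Fintype U] {T : (⊤ : SimpleGraph V).Subgraph}
    {C : Set (⊤ : SimpleGraph V).Subgraph} (hT : IsCopy S T) (hC : IsCovering H T C) :
    C.ncard ≤ Fintype.card U + Fintype.card U * Fintype.card U := by
  obtain ⟨f, rfl⟩ := hT.exists_placed
  let cov : U ⊕ U × U → (⊤ : SimpleGraph V).Subgraph → Prop := fun x L =>
    Sum.elim (fun u => f u ∈ L.verts) (fun p => L.Adj (f p.1) (f p.2)) x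
  have key : ∀ K : C, ∃ x, (∃ L ∈ C, cov x L) ∧ ∀ L ∈ C, cov x L → L = K := by
    rintro ⟨K, hK⟩
    by_contra! hcon
    refine hC.minimal K hK ⟨?_, ?_⟩
    · rw [placed_verts]
      rintro _ ⟨u, rfl⟩
      have h1 : f u ∈ (sSup C).verts := hC.covers.1 (by simp)
      simp only [SimpleGraph.Subgraph.verts_sSup, Set.mem_iUnion, exists_prop] at h1
      obtain ⟨L, hL, hcov, hne⟩ := hcon (Sum.inl u) h1
      simp only [SimpleGraph.Subgraph.verts_sSup, Set.mem_iUnion, exists_prop]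
      exact ⟨L, ⟨hL, hne⟩, hcov⟩
    · rintro _ _ hxy
      obtain ⟨a, b, -, rfl, rfl⟩ := (placed_adj f).1 hxy
      have h1 : (sSup C).Adj (f a) (f b) := hC.covers.2 hxy
      rw [SimpleGraph.Subgraph.sSup_adj] at h1
      obtain ⟨L, hL, hcov, hne⟩ := hcon (Sum.inr (a, b)) h1
      rw [SimpleGraph.Subgraph.sSup_adj]
      exact ⟨L, ⟨hL, hne⟩, hcov⟩
  choose g hg using key
  have hinj : Function.Injective g := by
    intro K K' hKK'
    obtain ⟨L, hL, hcov⟩ := (hg K).1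
    have h1 := (hg K).2 L hL hcov
    have h2 := (hg K').2 L hL (hKK' ▸ hcov)
    exact Subtype.ext (h1.symm.trans h2)
  calc C.ncard = Nat.card C := rfl
    _ ≤ Nat.card (U ⊕ U × U) := Nat.card_le_card_of_injective g hinj
    _ = _ := by simp

theorem nonempty_of_isContained (hS : S ≠ ⊥) {F : Set (⊤ : SimpleGraph V).Subgraph}
    (h : S ⊑ (sSup F).spanningCoe) : F.Nonempty := by
  obtain ⟨a, b, hab⟩ := SimpleGraph.ne_bot_iff_exists_adj.1 hS
  obtain ⟨φ⟩ := h
  have := φ.toHom.map_adj hab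
  rw [SimpleGraph.Subgraph.spanningCoe_adj, SimpleGraph.Subgraph.sSup_adj] at this
  obtain ⟨K, hK, -⟩ := this
  exact ⟨K, hK⟩

theorem IsCovering.nonempty {T : (⊤ : SimpleGraph V).Subgraph}
    {C : Set (⊤ : SimpleGraph V).Subgraph} (hS : S ≠ ⊥) (hT : IsCopy S T)
    (hC : IsCovering H T C) : C.Nonempty :=
  nonempty_of_isContained hS (hT.isContained_spanningCoe hC.covers)

theorem gamma_nonneg (C : Set (⊤ : SimpleGraph V).Subgraph) : 0 ≤ gamma C := by
  apply Real.sInf_nonneg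
  rintro _ ⟨D, -, -, rfl⟩
  positivity

theorem gamma_le {C D : Set (⊤ : SimpleGraph V).Subgraph} (hD : D ⊆ C) (hne : D.Nonempty) :
    gamma C ≤ ((sSup D).verts.ncard : ℝ) / (D.ncard : ℝ) := by
  refine csInf_le ⟨0, ?_⟩ ⟨D, hD, hne, rfl⟩
  rintro _ ⟨D, -, -, rfl⟩
  positivity

theorem gamma_mul_ncard_le {C D : Set (⊤ : SimpleGraph V).Subgraph} (hC : C.Finite) (hD : D ⊆ C)
    (hne : D.Nonempty) : gamma C * D.ncard ≤ (sSup D).verts.ncard := by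
  have : (0 : ℝ) < D.ncard := by exact_mod_cast (Set.ncard_pos (hC.subset hD)).2 hne
  exact (le_div_iff₀ this).1 (gamma_le hD hne)

theorem exists_gamma_eq {C : Set (⊤ : SimpleGraph V).Subgraph} (hC : C.Finite)
    (hne : C.Nonempty) :
    ∃ D ⊆ C, D.Nonempty ∧ gamma C = ((sSup D).verts.ncard : ℝ) / (D.ncard : ℝ) := by
  have hfin : {r : ℝ | ∃ D ⊆ C, D.Nonempty ∧
      r = ((sSup D).verts.ncard : ℝ) / (D.ncard : ℝ)}.Finite := by
    refine (hC.finite_subsets.image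
      fun D => ((sSup D).verts.ncard : ℝ) / (D.ncard : ℝ)).subset ?_
    rintro _ ⟨D, hD, -, rfl⟩
    exact ⟨D, hD, rfl⟩
  have hmem : gamma C ∈ {r : ℝ | ∃ D ⊆ C, D.Nonempty ∧
      r = ((sSup D).verts.ncard : ℝ) / (D.ncard : ℝ)} :=
    Set.Nonempty.csInf_mem ⟨_, ⟨C, subset_rfl, hne, rfl⟩⟩ hfin
  exact hmem

theorem gamma_le_card {C : Set (⊤ : SimpleGraph V).Subgraph} (hne : C.Nonempty)
    (hC : ∀ K ∈ C, IsCopy H K) : gamma C ≤ Nat.card W := by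
  obtain ⟨K, hK⟩ := hne
  refine (gamma_le (Set.singleton_subset_iff.2 hK) (Set.singleton_nonempty K)).trans ?_
  simp [(hC K hK).ncard_verts]

theorem ncard_verts_sSup_le {D : Set (⊤ : SimpleGraph V).Subgraph} (hD : D.Finite)
    (h : ∀ K ∈ D, IsCopy H K) : (sSup D).verts.ncard ≤ D.ncard * Nat.card W := by
  rw [SimpleGraph.Subgraph.verts_sSup]
  have := hD.toFinset.set_ncard_biUnion_le (fun K : (⊤ : SimpleGraph V).Subgraph => K.verts)
  simp only [Set.Finite.mem_toFinset] at this
  refine this.trans ?_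
  rw [Finset.sum_congr rfl (g := fun _ => Nat.card W)]
  · simp [Set.ncard_eq_toFinset_card D hD]
  · intro K hK
    exact (h K (by simpa using hK)).ncard_verts

theorem bddAbove_gamma (hS : S ≠ ⊥) :
    BddAbove {r | ∃ T : (⊤ : SimpleGraph ℕ).Subgraph, IsCopy S T ∧
      ∃ C : Set (⊤ : SimpleGraph ℕ).Subgraph, IsCovering H T C ∧ r = gamma C} := by
  refine ⟨Nat.card W, ?_⟩
  rintro _ ⟨T, hT, C, hC, rfl⟩
  exact gamma_le_card (hC.nonempty hS hT) hC.isCopy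

/-- Since `gammaBar` ranges over coverings inside `ℕ` only, a covering living elsewhere is first
injected into `ℕ`. -/
theorem gamma_le_gammaBar [Countable V] (hS : S ≠ ⊥) {T : (⊤ : SimpleGraph V).Subgraph}
    {C : Set (⊤ : SimpleGraph V).Subgraph} (hT : IsCopy S T) (hC : IsCovering H T C) :
    gamma C ≤ gammaBar S H := by
  obtain ⟨f, hf⟩ := exists_injective_nat V
  let f : V ↪ ℕ := ⟨f, hf⟩
  rw [← gamma_relabel f]
  exact le_csSup (bddAbove_gamma hS)
    ⟨relabel f T, (isCopy_relabel f).2 hT, relabel f '' C, hC.relabel f, rfl⟩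

/-- The set of values of `gamma` on coverings is finite. -/
theorem finite_gamma [Fintype U] (hS : S ≠ ⊥) :
    {r | ∃ T : (⊤ : SimpleGraph ℕ).Subgraph, IsCopy S T ∧
      ∃ C : Set (⊤ : SimpleGraph ℕ).Subgraph, IsCovering H T C ∧ r = gamma C}.Finite := by
  let L := Fintype.card U + Fintype.card U * Fintype.card U
  -- Every value of `gamma` is a fraction whose numerator and denominator are bounded in terms of
  -- `U` and `W`.
  refine (((Set.finite_Iic (L * Nat.card W)).prod (Set.finite_Iic L)).image
    fun p : ℕ × ℕ => (p.1 : ℝ) / (p.2 : ℝ)).subset ?_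
  rintro _ ⟨T, hT, C, hC, rfl⟩
  obtain ⟨D, hDC, -, h⟩ := exists_gamma_eq hC.finite (hC.nonempty hS hT)
  have h1 : D.ncard ≤ L := (Set.ncard_le_ncard hDC hC.finite).trans (hC.ncard_le hT)
  have h2 := ncard_verts_sSup_le (hC.finite.subset hDC) fun K hK => hC.isCopy K (hDC hK)
  exact ⟨((sSup D).verts.ncard, D.ncard), ⟨h2.trans (Nat.mul_le_mul_right _ h1), h1⟩, h.symm⟩

/-- Two elements of `W` can be sent to two prescribed elements of `U` by an injection of `W` into
`U ⊕ W`. -/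
theorem exists_embedding_sum {w w' : W} {u u' : U} (hw : w ≠ w') (hu : u ≠ u') :
    ∃ f : W ↪ U ⊕ W, f w = Sum.inl u ∧ f w' = Sum.inl u' := by
  classical
  refine ⟨⟨fun x => if x = w then Sum.inl u else if x = w' then Sum.inl u' else Sum.inr x, ?_⟩,
    if_pos rfl, (if_neg hw.symm).trans (if_pos rfl)⟩
  intro x y hxy
  dsimp only at hxy
  split_ifs at hxy <;> simp_all

/-- One edge of `H` suffices: it can be laid over any vertex or edge of `S`, with the rest of `H`
placed on the fresh points of `W`. All copies inside `U ⊕ W` therefore cover `S`, and a minimal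
subfamily is a covering. -/
theorem exists_isCovering [Fintype U] [Fintype W] [Nonempty W] (hH : ∀ w, ¬ H.IsIsolated w) :
    ∃ T : (⊤ : SimpleGraph ℕ).Subgraph, IsCopy S T ∧
      ∃ C : Set (⊤ : SimpleGraph ℕ).Subgraph, IsCovering H T C := by
  classical
  obtain ⟨w⟩ := ‹Nonempty W›
  obtain ⟨w', hw⟩ : ∃ w', H.Adj w w' := by
    simpa [SimpleGraph.IsIsolated] using hH w
  let T : (⊤ : SimpleGraph (U ⊕ W)).Subgraph := placed S Function.Embedding.inl
  let F : Set (⊤ : SimpleGraph (U ⊕ W)).Subgraph := {K | IsCopy H K}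
  have hT : T ≤ sSup F := by
    refine ⟨?_, ?_⟩
    · rintro x hx
      simp only [T, placed_verts] at hx
      obtain ⟨u, rfl⟩ := hx
      let f : W ↪ U ⊕ W := ⟨fun x => if x = w then Sum.inl u else Sum.inr x, by
        intro x y hxy
        dsimp only at hxy
        split_ifs at hxy <;> simp_all⟩
      simp only [SimpleGraph.Subgraph.verts_sSup, Set.mem_iUnion, exists_prop]
      exact ⟨placed H f, isCopy_placed f, by rw [placed_verts]; exact ⟨w, if_pos rfl⟩⟩
    · intro x y hxy
      obtain ⟨a, b, hab, rfl, rfl⟩ := (placed_adj _).1 hxy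
      obtain ⟨f, h1, h2⟩ := exists_embedding_sum hw.ne hab.ne
      rw [SimpleGraph.Subgraph.sSup_adj]
      exact ⟨placed H f, isCopy_placed f, (placed_adj f).2 ⟨w, w', hw, h1, h2⟩⟩
  obtain ⟨C, -, hC⟩ := exists_isCovering_subset (H := H) (Set.toFinite F) (fun K hK => hK) hT
  obtain ⟨f, hf⟩ := exists_injective_nat (U ⊕ W)
  let f : U ⊕ W ↪ ℕ := ⟨f, hf⟩
  exact ⟨relabel f T, (isCopy_relabel f).2 (isCopy_placed _), _, hC.relabel f⟩

theorem exists_gamma_eq_gammaBar [Fintype U] [Fintype W] [Nonempty W] (hH : ∀ w, ¬ H.IsIsolated w)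
    (hS : S ≠ ⊥) :
    ∃ T : (⊤ : SimpleGraph ℕ).Subgraph, IsCopy S T ∧
      ∃ C : Set (⊤ : SimpleGraph ℕ).Subgraph, IsCovering H T C ∧ gammaBar S H = gamma C := by
  obtain ⟨T, hT, C, hC⟩ := exists_isCovering (S := S) hH
  have hmem : gammaBar S H ∈ {r | ∃ T : (⊤ : SimpleGraph ℕ).Subgraph, IsCopy S T ∧
      ∃ C : Set (⊤ : SimpleGraph ℕ).Subgraph, IsCovering H T C ∧ r = gamma C} :=
    Set.Nonempty.csSup_mem ⟨_, ⟨T, hT, C, hC, rfl⟩⟩ (finite_gamma hS)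
  exact hmem

theorem gammaBar_nonneg (S : SimpleGraph U) (H : SimpleGraph W) : 0 ≤ gammaBar S H := by
  apply Real.sSup_nonneg
  rintro _ ⟨T, -, C, -, rfl⟩
  exact gamma_nonneg C

theorem gammaBar_le_card (hS : S ≠ ⊥) : gammaBar S H ≤ Nat.card W := by
  refine Real.sSup_le ?_ (by positivity)
  rintro _ ⟨T, hT, C, hC, rfl⟩
  exact gamma_le_card (hC.nonempty hS hT) hC.isCopy

/-- Every family of copies of `H` whose union contains `S` contains a small nonempty subfamily
with few vertices. Isolated vertices of `S` are covered by additional disjoint copies. -/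
theorem exists_sparse_subfamily [Fintype U] [Fintype V] [Fintype W] [Nonempty W] (hS : S ≠ ⊥)
    {F : Set (⊤ : SimpleGraph V).Subgraph} (hF : ∀ K ∈ F, IsCopy H K)
    (h : S ⊑ (sSup F).spanningCoe) :
    ∃ D ⊆ F, D.Nonempty ∧ D.ncard ≤ Fintype.card U + Fintype.card U * Fintype.card U ∧
      ((sSup D).verts.ncard : ℝ) ≤ gammaBar S H * D.ncard := by
  classical
  obtain ⟨K₀, hK₀⟩ := nonempty_of_isContained hS h
  obtain ⟨w⟩ := ‹Nonempty W›
  obtain ⟨a₀, b₀, hab₀⟩ := SimpleGraph.ne_bot_iff_exists_adj.1 hS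
  obtain ⟨φ⟩ := h
  have hφ : ∀ {a b}, S.Adj a b → ∃ K ∈ F, K.Adj (φ a) (φ b) := fun {a b} hab => by
    have := φ.toHom.map_adj hab
    rwa [SimpleGraph.Subgraph.spanningCoe_adj, SimpleGraph.Subgraph.sSup_adj] at this
  -- Containment of `S` in the spanning graph does not put its isolated vertices inside any chosen
  -- copy. Each isolated `u` is therefore moved to a fresh copy `κ u` of `H`, disjoint from
  -- everything else.
  let ψ : U ↪ V ⊕ U × W :=
    ⟨fun u => if S.IsIsolated u then Sum.inr (u, w) else Sum.inl (φ u), by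
      intro x y hxy
      dsimp only at hxy
      split_ifs at hxy
      · simpa using hxy
      · exact φ.injective (Sum.inl_injective hxy)⟩
  let inl : V ↪ V ⊕ U × W := Function.Embedding.inl
  let κ : U → W ↪ V ⊕ U × W := fun u =>
    ⟨fun x => Sum.inr (u, x), fun x y hxy => by simpa using hxy⟩
  let T := placed S ψ
  let F' := relabel inl '' F ∪ Set.range fun u => placed H (κ u)
  have hcopy : ∀ K ∈ F', IsCopy H K := by
    rintro K (⟨L, hL, rfl⟩ | ⟨u, rfl⟩)
    · exact (isCopy_relabel _).2 (hF L hL)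
    · exact isCopy_placed _
  have hψ : ∀ {a b}, S.Adj a b → ψ a = Sum.inl (φ a) := fun {a b} hab => by
    have : ¬ S.IsIsolated a := fun hi => hi b hab
    exact if_neg this
  have hadj : ∀ {a b}, S.Adj a b → (sSup F').Adj (ψ a) (ψ b) := fun {a b} hab => by
    obtain ⟨K, hK, hKab⟩ := hφ hab
    rw [SimpleGraph.Subgraph.sSup_adj, hψ hab, hψ hab.symm]
    exact ⟨relabel inl K, Or.inl ⟨K, hK, rfl⟩, (relabel_adj_apply inl K).2 hKab⟩
  have hT : T ≤ sSup F' := by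
    refine ⟨?_, ?_⟩
    · intro x hx
      simp only [T, placed_verts] at hx
      obtain ⟨u, rfl⟩ := hx
      by_cases hu : S.IsIsolated u
      · simp only [SimpleGraph.Subgraph.verts_sSup, Set.mem_iUnion, exists_prop]
        refine ⟨placed H (κ u), Or.inr ⟨u, rfl⟩, ?_⟩
        rw [placed_verts]
        exact ⟨w, (if_pos hu).symm⟩
      · obtain ⟨v, hv⟩ : ∃ v, S.Adj u v := by simpa [SimpleGraph.IsIsolated] using hu
        exact (sSup F').edge_vert (hadj hv)
    · intro x y hxy
      obtain ⟨a, b, hab, rfl, rfl⟩ := (placed_adj _).1 hxy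
      exact hadj hab
  have hF'fin : F'.Finite := Set.toFinite F'
  obtain ⟨C, hCF, hC⟩ := exists_isCovering_subset (H := H) hF'fin hcopy hT
  have hTS : IsCopy S T := isCopy_placed ψ
  obtain ⟨D, hDC, hDne, hD⟩ := exists_gamma_eq hC.finite (hC.nonempty hS hTS)
  have hDfin : D.Finite := hC.finite.subset hDC
  have hDpos : (0 : ℝ) < D.ncard := by exact_mod_cast (Set.ncard_pos hDfin).2 hDne
  have hDle : ((sSup D).verts.ncard : ℝ) ≤ gammaBar S H * D.ncard := by
    rw [← div_le_iff₀ hDpos, ← hD]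
    exact gamma_le_gammaBar hS hTS hC
  have hDcard := (Set.ncard_le_ncard hDC hC.finite).trans (hC.ncard_le hTS)
  -- The sparse set `D` found in the enlarged family is split into its genuine part `D'` and the
  -- indices `I` of its auxiliary copies. Removing the latter costs `I.ncard` copies and exactly
  -- `Nat.card W` vertices each.
  let D' : Set (⊤ : SimpleGraph V).Subgraph := {K | K ∈ F ∧ relabel inl K ∈ D}
  let I : Set U := {u | placed H (κ u) ∈ D}
  have hDsub : D ⊆ relabel inl '' D' ∪ (fun u => placed H (κ u)) '' I := by
    intro K hK
    rcases hCF (hDC hK) with ⟨L, hL, rfl⟩ | ⟨u, rfl⟩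
    · exact Or.inl ⟨L, ⟨hL, hK⟩, rfl⟩
    · exact Or.inr ⟨u, hK, rfl⟩
  have hcard1 : D.ncard ≤ D'.ncard + I.ncard := by
    refine (Set.ncard_le_ncard hDsub (Set.toFinite _)).trans ((Set.ncard_union_le _ _).trans ?_)
    exact add_le_add (Set.ncard_image_le (Set.toFinite _)) (Set.ncard_image_le (Set.toFinite _))
  have hcard2 : (sSup D').verts.ncard + I.ncard * Nat.card W ≤ (sSup D).verts.ncard := by
    have hsub : (Sum.inl '' (sSup D').verts ∪ Sum.inr '' (I ×ˢ (Set.univ : Set W)) :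
        Set (V ⊕ U × W)) ⊆ (sSup D).verts := by
      simp only [SimpleGraph.Subgraph.verts_sSup]
      rintro x (⟨v, hv, rfl⟩ | ⟨⟨u, x⟩, hu, rfl⟩)
      · simp only [Set.mem_iUnion, exists_prop] at hv ⊢
        obtain ⟨K, hK, hv⟩ := hv
        exact ⟨_, hK.2, ⟨v, hv, rfl⟩⟩
      · simp only [Set.mem_iUnion, exists_prop]
        refine ⟨_, hu.1, ?_⟩
        rw [placed_verts]
        exact ⟨x, rfl⟩
    refine le_trans (le_of_eq ?_) (Set.ncard_le_ncard hsub (Set.toFinite _))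
    rw [Set.ncard_union_eq _ (Set.toFinite _) (Set.toFinite _),
      Set.ncard_image_of_injective _ Sum.inl_injective,
      Set.ncard_image_of_injective _ Sum.inr_injective, Set.ncard_prod, Set.ncard_univ]
    rw [Set.disjoint_left]
    rintro _ ⟨v, -, rfl⟩ ⟨u, -, hu⟩
    simp at hu
  have hD'card : D'.ncard ≤ D.ncard := by
    rw [← Set.ncard_image_of_injective D' (relabel_injective inl)]
    refine Set.ncard_le_ncard ?_ hDfin
    rintro _ ⟨K, hK, rfl⟩
    exact hK.2
  have h0 := gammaBar_nonneg S H
  by_contra! hcon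
  -- If `gammaBar S H ≥ Nat.card W`, the single copy `K₀` would already be sparse enough.
  have hlt : gammaBar S H < Nat.card W := by
    have := hcon {K₀} (Set.singleton_subset_iff.2 hK₀) (Set.singleton_nonempty _) (by
      rw [Set.ncard_singleton]
      have : 0 < Fintype.card U := Fintype.card_pos_iff.2 ⟨a₀⟩
      omega)
    simpa [(hF K₀ hK₀).ncard_verts] using this
  have hcard1' : (D.ncard : ℝ) ≤ D'.ncard + I.ncard := by exact_mod_cast hcard1
  have hcard2' : ((sSup D').verts.ncard : ℝ) + I.ncard * Nat.card W ≤ (sSup D).verts.ncard := by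
    exact_mod_cast hcard2
  have h1 : gammaBar S H * D.ncard ≤ gammaBar S H * (D'.ncard + I.ncard) :=
    mul_le_mul_of_nonneg_left hcard1' h0
  have h2 : (I.ncard : ℝ) * gammaBar S H ≤ I.ncard * Nat.card W :=
    mul_le_mul_of_nonneg_left hlt.le (by positivity)
  -- Each auxiliary copy has more than `gammaBar S H` vertices, so `D` cannot consist of such copies
  -- only, and discarding them keeps `D'` sparse.
  rcases D'.eq_empty_or_nonempty with hD' | hD'
  · have hI : (0 : ℝ) < I.ncard := by
      rw [hD', Set.ncard_empty] at hcard1'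
      simp only [Nat.cast_zero, zero_add] at hcard1'
      linarith
    have h3 : (I.ncard : ℝ) * gammaBar S H < I.ncard * Nat.card W :=
      mul_lt_mul_of_pos_left hlt hI
    rw [hD', Set.ncard_empty] at h1
    have h4 : (0 : ℝ) ≤ (sSup D').verts.ncard := by positivity
    simp only [Nat.cast_zero, zero_add] at h1
    linarith
  · have := hcon D' (fun K hK => hK.1) hD' (hD'card.trans hDcard)
    linarith

end Covering

/-! ### Inclusion probabilities and the second moment for uniform m-subsets -/

section UniformSubset

/-- The probability that a uniformly random `m`-subset of an `N`-set contains a given `a`-set. -/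
noncomputable def inclusionProb (N m a : ℕ) : ℝ :=
  ∏ i ∈ Finset.range a, ((m - i : ℕ) : ℝ) / ((N - i : ℕ) : ℝ)

theorem inclusionProb_nonneg (N m a : ℕ) : 0 ≤ inclusionProb N m a :=
  Finset.prod_nonneg fun _ _ => by positivity

theorem sub_div_sub_le {N m : ℕ} (h : m ≤ N) {i j : ℕ} (hij : i ≤ j) :
    ((m - j : ℕ) : ℝ) / ((N - j : ℕ) : ℝ) ≤ ((m - i : ℕ) : ℝ) / ((N - i : ℕ) : ℝ) := by
  rcases le_or_gt m j with hj | hj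
  · rw [Nat.sub_eq_zero_of_le hj]
    simp only [Nat.cast_zero, zero_div]
    positivity
  · rw [div_le_div_iff₀ (by exact_mod_cast (by omega : 0 < N - j))
      (by exact_mod_cast (by omega : 0 < N - i)), Nat.cast_sub (by omega), Nat.cast_sub (by omega),
      Nat.cast_sub (by omega), Nat.cast_sub (by omega)]
    have h1 : (i : ℝ) ≤ j := by exact_mod_cast hij
    have h2 : (m : ℝ) ≤ N := by exact_mod_cast h
    nlinarith [mul_nonneg (sub_nonneg.2 h1) (sub_nonneg.2 h2)]

/-- Negative correlation: in sampling without replacement the successive factors decrease, so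
containing two disjoint sets is at most as likely as under independence. -/
theorem inclusionProb_add_le {N m : ℕ} (h : m ≤ N) (a b : ℕ) :
    inclusionProb N m (a + b) ≤ inclusionProb N m a * inclusionProb N m b := by
  rw [inclusionProb, Finset.prod_range_add]
  refine mul_le_mul_of_nonneg_left ?_ (inclusionProb_nonneg N m a)
  exact Finset.prod_le_prod (fun _ _ => by positivity) fun i _ => sub_div_sub_le h (by omega)

theorem inclusionProb_le_pow {N m : ℕ} (h : m ≤ N) (a : ℕ) :
    inclusionProb N m a ≤ ((m : ℝ) / N) ^ a := by
  rw [show ((m : ℝ) / N) ^ a = ∏ _i ∈ Finset.range a, (m : ℝ) / N by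
    rw [Finset.prod_const, Finset.card_range]]
  refine Finset.prod_le_prod (fun _ _ => by positivity) fun i _ => ?_
  simpa using sub_div_sub_le h (Nat.zero_le i)

/-- For `i < a` the condition `2 * a ≤ m` keeps `m - i` at least `m / 2`, while the denominator only
shrinks. -/
theorem pow_le_inclusionProb {N m a : ℕ} (h : m ≤ N) (ha : 2 * a ≤ m) :
    ((m : ℝ) / N / 2) ^ a ≤ inclusionProb N m a := by
  rw [show ((m : ℝ) / N / 2) ^ a = ∏ _i ∈ Finset.range a, (m : ℝ) / N / 2 by
    rw [Finset.prod_const, Finset.card_range]]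
  refine Finset.prod_le_prod (fun _ _ => by positivity) fun i hi => ?_
  rw [Finset.mem_range] at hi
  have h1 : (0 : ℝ) < ((N - i : ℕ) : ℝ) := by exact_mod_cast (by omega : 0 < N - i)
  have h2 : ((N - i : ℕ) : ℝ) ≤ N := by exact_mod_cast Nat.sub_le N i
  have h3 : (m : ℝ) ≤ 2 * ((m - i : ℕ) : ℝ) := by exact_mod_cast (by omega : m ≤ 2 * (m - i))
  calc (m : ℝ) / N / 2 = (m : ℝ) / 2 / N := by ring
    _ ≤ ((m - i : ℕ) : ℝ) / ((N - i : ℕ) : ℝ) :=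
      div_le_div₀ (by positivity) (by linarith) h1 h2

theorem choose_sub_sub {N m : ℕ} (h : m ≤ N) {a : ℕ} (ha : a ≤ m) :
    (((N - a).choose (m - a) : ℕ) : ℝ) = inclusionProb N m a * (N.choose m : ℕ) := by
  induction a with
  | zero => simp [inclusionProb]
  | succ a ih =>
    rw [inclusionProb, Finset.prod_range_succ, ← inclusionProb, mul_right_comm, ← ih (by omega)]
    have h1 : (0 : ℝ) < ((N - a : ℕ) : ℝ) := by exact_mod_cast (by omega : 0 < N - a)
    rw [mul_div_assoc', eq_div_iff h1.ne']
    have := Nat.add_one_mul_choose_eq (N - (a + 1)) (m - (a + 1))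
    rw [show N - (a + 1) + 1 = N - a by omega, show m - (a + 1) + 1 = m - a by omega] at this
    rw [mul_comm]
    exact_mod_cast this

variable {α ι : Type*} [DecidableEq α]

theorem card_filter_subset_powersetCard {A X : Finset α} {m : ℕ} (hA : A ⊆ X) (hm : m ≤ X.card) :
    (((X.powersetCard m).filter (A ⊆ ·)).card : ℝ) =
      inclusionProb X.card m A.card * (X.card.choose m : ℕ) := by
  rcases le_or_gt A.card m with h | h
  · rw [Finset.card_filter_powersetCard_subset A X m hA h, choose_sub_sub hm h]
  · have h1 : (X.powersetCard m).filter (A ⊆ ·) = ∅ := by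
      rw [Finset.filter_eq_empty_iff]
      intro F hF hAF
      have := Finset.card_le_card hAF
      rw [(Finset.mem_powersetCard.1 hF).2] at this
      omega
    -- The factor with index `m` has numerator `m - m = 0`.
    have h2 : inclusionProb X.card m A.card = 0 :=
      Finset.prod_eq_zero (Finset.mem_range.2 h) (by simp)
    simp [h1, h2]

/-- **Second moment bound** for the number of `m`-subsets of `X` containing none of the `φ i`. -/
theorem card_forall_not_subset_le {X : Finset α} {m k : ℕ} (hm : m ≤ X.card)
    (I : Finset ι) (φ : ι → Finset α) (hφ : ∀ i ∈ I, φ i ⊆ X) (hk : ∀ i ∈ I, (φ i).card = k)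
    {B : Finset (Finset α)} (hBX : B ⊆ X.powersetCard m) (hB : ∀ F ∈ B, ∀ i ∈ I, ¬ φ i ⊆ F)
    {P : Finset (ι × ι)} (hP : ∀ i ∈ I, ∀ j ∈ I, ¬ Disjoint (φ i) (φ j) → (i, j) ∈ P) :
    (B.card : ℝ) *
        (I.card * inclusionProb X.card m k) ^ 2 ≤
      (X.card.choose m : ℕ) * ∑ p ∈ P, inclusionProb X.card m (φ p.1 ∪ φ p.2).card := by
  set Ω := X.powersetCard m with hΩ
  set q := inclusionProb X.card m with hq
  set M : ℝ := ((X.card.choose m : ℕ) : ℝ) with hM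
  set μ : ℝ := I.card * q k with hμ
  -- `Z F` counts the indices with `φ i ⊆ F`; its mean is `μ`, and it vanishes on `B`.
  let Z : Finset α → ℝ := fun F => ∑ i ∈ I, if φ i ⊆ F then 1 else 0
  have hsum : ∀ A ⊆ X, ∑ F ∈ Ω, (if A ⊆ F then (1 : ℝ) else 0) = q A.card * M := by
    intro A hA
    rw [← card_filter_subset_powersetCard hA hm, Finset.sum_boole]
  have hone : ∑ F ∈ Ω, Z F = μ * M := by
    simp only [Z]
    rw [Finset.sum_comm, Finset.sum_congr rfl fun i hi => hsum _ (hφ i hi),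
      Finset.sum_congr rfl fun i hi => by rw [hk i hi]]
    simp [hμ, mul_assoc]
  have htwo : ∑ F ∈ Ω, Z F ^ 2 = M * ∑ p ∈ I ×ˢ I, q (φ p.1 ∪ φ p.2).card := by
    have : ∀ F, Z F ^ 2 = ∑ p ∈ I ×ˢ I, if φ p.1 ∪ φ p.2 ⊆ F then (1 : ℝ) else 0 := by
      intro F
      simp only [Z]
      rw [sq, Finset.sum_mul_sum, Finset.sum_product]
      refine Finset.sum_congr rfl fun i _ => Finset.sum_congr rfl fun j _ => ?_
      by_cases h1 : φ i ⊆ F <;> by_cases h2 : φ j ⊆ F <;> simp [h1, h2, Finset.union_subset_iff]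
    simp only [this]
    rw [Finset.sum_comm, Finset.mul_sum]
    refine Finset.sum_congr rfl fun p hp => ?_
    rw [Finset.mem_product] at hp
    rw [hsum _ (Finset.union_subset (hφ _ hp.1) (hφ _ hp.2)), mul_comm]
  have hcardΩ : (Ω.card : ℝ) = M := by rw [hΩ, Finset.card_powersetCard]
  have hcheb : (B.card : ℝ) * μ ^ 2 ≤
      ∑ F ∈ Ω, (Z F - μ) ^ 2 := by
    rw [← nsmul_eq_mul, ← Finset.sum_const]
    have h1 : ∀ F ∈ B, μ ^ 2 = (Z F - μ) ^ 2 := by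
      intro F hF
      have : Z F = 0 := Finset.sum_eq_zero fun i hi => if_neg (hB F hF i hi)
      rw [this]
      ring
    rw [Finset.sum_congr rfl h1]
    exact Finset.sum_le_sum_of_subset_of_nonneg hBX
      fun _ _ _ => sq_nonneg _
  have hvar : ∑ F ∈ Ω, (Z F - μ) ^ 2 = M * ∑ p ∈ I ×ˢ I, (q (φ p.1 ∪ φ p.2).card - q k * q k) := by
    have h1 : ∑ F ∈ Ω, (Z F - μ) ^ 2 = ∑ F ∈ Ω, Z F ^ 2 - 2 * μ * ∑ F ∈ Ω, Z F + M * μ ^ 2 := by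
      rw [← hcardΩ, ← nsmul_eq_mul, ← Finset.sum_const, Finset.mul_sum, ← Finset.sum_sub_distrib,
        ← Finset.sum_add_distrib]
      exact Finset.sum_congr rfl fun F _ => by ring
    rw [h1, hone, htwo, Finset.sum_sub_distrib, Finset.sum_const, Finset.card_product,
      nsmul_eq_mul, hμ]
    push_cast
    ring
  rw [hvar] at hcheb
  refine hcheb.trans (mul_le_mul_of_nonneg_left ?_ (by positivity))
  -- Disjoint pairs have nonpositive covariance and are dropped; for the other pairs the subtracted
  -- product is dropped.
  calc ∑ p ∈ I ×ˢ I, (q (φ p.1 ∪ φ p.2).card - q k * q k)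
      ≤ ∑ p ∈ I ×ˢ I, if ¬ Disjoint (φ p.1) (φ p.2) then q (φ p.1 ∪ φ p.2).card else 0 := by
        refine Finset.sum_le_sum fun p hp => ?_
        rw [Finset.mem_product] at hp
        split_ifs with hdis
        · rw [Finset.card_union_of_disjoint hdis, hk _ hp.1, hk _ hp.2]
          linarith [inclusionProb_add_le hm k k]
        · have := inclusionProb_nonneg X.card m k
          linarith [mul_nonneg this this]
    _ ≤ ∑ p ∈ P, q (φ p.1 ∪ φ p.2).card := by
        rw [← Finset.sum_filter]
        refine Finset.sum_le_sum_of_subset_of_nonneg (fun p hp => ?_)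
          fun _ _ _ => inclusionProb_nonneg _ _ _
        rw [Finset.mem_filter, Finset.mem_product] at hp
        exact hP _ hp.1.1 _ hp.1.2 hp.2

end UniformSubset

/-! ### Counting copies of H and families of copies -/

section Counting

variable {U W : Type*}

open Classical in
/-- The finite set of all copies of `H` in the complete graph on `n` vertices. -/
noncomputable def copies (H : SimpleGraph W) (n : ℕ) :
    Finset (⊤ : SimpleGraph (Fin n)).Subgraph :=
  Finset.univ.filter fun K => IsCopy H K

@[simp]
theorem mem_copies {H : SimpleGraph W} {n : ℕ} {K : (⊤ : SimpleGraph (Fin n)).Subgraph} :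
    K ∈ copies H n ↔ IsCopy H K := by
  simp [copies]

theorem card_copies (H : SimpleGraph W) (n : ℕ) :
    (copies H n).card = (⊤ : SimpleGraph (Fin n)).copyCount H := by
  classical
  rw [SimpleGraph.copyCount, copies]
  congr!

instance measurableSingletonClass_simpleGraph {V : Type*} [Countable V] :
    MeasurableSingletonClass (SimpleGraph V) :=
  ⟨fun G => ⟨{G.Adj}, measurableSet_singleton _, by
    ext G'
    exact SimpleGraph.adj_inj⟩⟩

open Classical in
-- Reduces probabilities to counting `m`-subsets of `copies H n`. When there are fewer than `m`
-- copies both sides are `0`.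
theorem uniformMotifGraph_real (H : SimpleGraph W) {n m : ℕ} (P : SimpleGraph (Fin n) → Prop) :
    (uniformMotifGraph H n m).real {G | P G} =
      (((copies H n).powersetCard m).filter
        fun F : Finset (⊤ : SimpleGraph (Fin n)).Subgraph =>
          P (sSup (F : Set (⊤ : SimpleGraph (Fin n)).Subgraph)).spanningCoe).card /
      ((copies H n).card.choose m : ℕ) := by
  set X := copies H n
  let e : Finset (⊤ : SimpleGraph (Fin n)).Subgraph ↪ Set (⊤ : SimpleGraph (Fin n)).Subgraph :=
    ⟨fun F => (F : Set _), Finset.coe_injective⟩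
  have hfam : copyFamilies H n m = ((X.powersetCard m).map e : Set _) := by
    ext F
    simp only [copyFamilies, Set.mem_ofPred_eq, Finset.coe_map, Set.mem_image, Finset.mem_coe,
      Finset.mem_powersetCard]
    constructor
    · rintro ⟨h1, h2⟩
      refine ⟨F.toFinite.toFinset, ⟨fun K hK => ?_, ?_⟩, by simp [e]⟩
      · exact mem_copies.2 (h1 K (by simpa using hK))
      · rw [← h2, Set.ncard_eq_toFinset_card F F.toFinite]
    · rintro ⟨F, ⟨h1, h2⟩, rfl⟩
      exact ⟨fun K hK => mem_copies.1 (h1 hK), by rw [← h2]; exact Set.ncard_coe_finset F⟩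
  rw [uniformMotifGraph, MeasureTheory.Measure.real,
    MeasureTheory.Measure.map_apply (measurable_of_finite _) (Set.toFinite _).measurableSet, hfam]
  have hpre : ((fun F : Set (⊤ : SimpleGraph (Fin n)).Subgraph => (sSup F).spanningCoe) ⁻¹'
      {G | P G}) = ((Finset.univ.filter fun F : Set (⊤ : SimpleGraph (Fin n)).Subgraph =>
        P (sSup F).spanningCoe : Finset _) : Set _) := by
    ext F
    simp
  rw [hpre, ProbabilityTheory.uniformOn_apply_finset, ENNReal.toReal_div, ENNReal.toReal_natCast,
    ENNReal.toReal_natCast, Finset.card_map, Finset.card_powersetCard]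
  refine congrArg (fun k : ℕ => (k : ℝ) / _) ?_
  rw [← Finset.card_map e]
  refine congrArg Finset.card (Finset.ext fun F => ?_)
  simp only [Finset.mem_inter, Finset.mem_map, Finset.mem_filter, Finset.mem_univ, true_and]
  constructor
  · rintro ⟨⟨F, hF, rfl⟩, h⟩
    exact ⟨F, ⟨hF, h⟩, rfl⟩
  · rintro ⟨F, ⟨hF, h⟩, rfl⟩
    exact ⟨⟨F, hF, rfl⟩, h⟩

theorem card_copies_le [Fintype W] (H : SimpleGraph W) (n : ℕ) :
    (copies H n).card ≤ n ^ Fintype.card W := by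
  classical
  have h : ∀ K : copies H n, ∃ f : W ↪ Fin n, placed H f = K := fun K =>
    (mem_copies.1 K.2).exists_placed
  choose f hf using h
  have hinj : Function.Injective fun K => (f K : W → Fin n) := by
    intro K L hKL
    rw [← Subtype.coe_inj, ← hf K, ← hf L, DFunLike.coe_injective hKL]
  have := Fintype.card_le_of_injective _ hinj
  rw [Fintype.card_coe] at this
  simpa using this

/-- One copy on each vertex set of size `Fintype.card W` already gives this many distinct copies. -/
theorem choose_le_card_copies [Fintype W] (H : SimpleGraph W) (n : ℕ) :
    n.choose (Fintype.card W) ≤ (copies H n).card := by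
  classical
  have h : ∀ s : (Finset.univ : Finset (Fin n)).powersetCard (Fintype.card W),
      ∃ f : W ↪ Fin n, Set.range f = s := by
    rintro ⟨s, hs⟩
    have hs' := (Finset.mem_powersetCard.1 hs).2
    let e : W ≃ s := Fintype.equivOfCardEq (by simp [hs'])
    refine ⟨e.toEmbedding.trans (Function.Embedding.subtype _), ?_⟩
    ext x
    constructor
    · rintro ⟨w, rfl⟩
      exact (e w).2
    · intro hx
      exact ⟨e.symm ⟨x, hx⟩, by simp⟩
  choose f hf using h
  have hinj : Function.Injective fun s => (⟨placed H (f s), mem_copies.2 (isCopy_placed _)⟩ :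
      copies H n) := by
    intro s t hst
    have := congrArg (fun K => SimpleGraph.Subgraph.verts (Subtype.val K)) hst
    simp only [placed_verts, hf] at this
    exact Subtype.ext (Finset.coe_injective this)
  have := Fintype.card_le_of_injective _ hinj
  rw [Fintype.card_coe, Fintype.card_coe] at this
  simpa using this

theorem pow_le_card_copies [Fintype W] (H : SimpleGraph W) {n : ℕ} (hn : 2 * Fintype.card W ≤ n) :
    (n : ℝ) ^ Fintype.card W / (2 ^ Fintype.card W * (Fintype.card W).factorial) ≤
      (copies H n).card := by
  set v := Fintype.card W
  have h1 : (((n + 1 - v : ℕ) : ℝ) ^ v) / v.factorial ≤ n.choose v := Nat.pow_le_choose v n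
  have h2 : ((n.choose v : ℕ) : ℝ) ≤ (copies H n).card := by
    exact_mod_cast choose_le_card_copies H n
  refine le_trans ?_ (h1.trans h2)
  rw [← div_div, ← div_pow]
  gcongr
  have : (n : ℝ) ≤ 2 * ((n + 1 - v : ℕ) : ℝ) := by exact_mod_cast (by omega : n ≤ 2 * (n + 1 - v))
  linarith

/-- The number of families of `d` copies of `H` that live on at most `a` vertices. -/
theorem card_families_le [Fintype W] [Nonempty W] (H : SimpleGraph W) {n a d : ℕ} (hd : d ≠ 0)
    (𝒟 : Finset (Finset (⊤ : SimpleGraph (Fin n)).Subgraph))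
    (h : ∀ D ∈ 𝒟, D.card = d ∧ (∀ K ∈ D, IsCopy H K) ∧
      (sSup (D : Set (⊤ : SimpleGraph (Fin n)).Subgraph)).verts.ncard ≤ a) :
    𝒟.card ≤ n ^ a * (a ^ Fintype.card W) ^ d := by
  classical
  -- A family is encoded by a list of `a` vertices containing its vertex set and, for each of its
  -- `d` copies, a map from `W` into the positions of that list. The equivalence says that the code
  -- determines the family.
  have key : ∀ D : 𝒟, ∃ p : (Fin a → Fin n) × (Fin d → W → Fin a), ∀ K,
      K ∈ (D : Finset (⊤ : SimpleGraph (Fin n)).Subgraph) ↔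
        ∃ i, ∃ f : W ↪ Fin n, ⇑f = p.1 ∘ p.2 i ∧ placed H f = K := by
    rintro ⟨D, hD⟩
    obtain ⟨hcard, hcopy, hverts⟩ := h D hD
    set A := (sSup (D : Set (⊤ : SimpleGraph (Fin n)).Subgraph)).verts with hA
    have hKA : ∀ K ∈ D, K.verts ⊆ A := fun K hK => (le_sSup (Finset.mem_coe.2 hK)).1
    obtain ⟨ε⟩ : Nonempty (A ↪ Fin a) := by
      refine Function.Embedding.nonempty_of_card_le ?_
      rwa [Fintype.card_fin, ← Nat.card_eq_fintype_card]
    -- `Function.invFun` needs a default vertex for list positions outside the range of `ε`; `d ≠ 0`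
    -- and `Nonempty W` supply one.
    have : Nonempty A := by
      obtain ⟨K, hK⟩ := Finset.card_pos.1 (by omega : 0 < D.card)
      obtain ⟨f, rfl⟩ := (hcopy K hK).exists_placed
      exact ⟨f (Classical.arbitrary W), hKA _ hK (by simp)⟩
    let e : Fin d ≃ D := (Fintype.equivFinOfCardEq (by simp [hcard])).symm
    have hplace : ∀ K : D, ∃ f : W ↪ Fin n, placed H f = K := fun K =>
      (hcopy K K.2).exists_placed
    choose f hf using hplace
    have hfA : ∀ K w, f K w ∈ A := fun K w => hKA K K.2 (by rw [← hf]; simp)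
    have hcomp : ∀ K, ⇑(f K) = (fun j => ((Function.invFun ε j : A) : Fin n)) ∘
        fun w => ε ⟨f K w, hfA K w⟩ := by
      intro K
      ext w
      simp [Function.leftInverse_invFun ε.injective _]
    refine ⟨(fun j => ((Function.invFun ε j : A) : Fin n), fun i w => ε ⟨f (e i) w, hfA (e i) w⟩),
      fun K => ⟨fun hK => ⟨e.symm ⟨K, hK⟩, f ⟨K, hK⟩, ?_, hf _⟩, ?_⟩⟩
    · simpa using hcomp ⟨K, hK⟩
    · rintro ⟨i, g, hg, rfl⟩
      have : g = f (e i) := DFunLike.coe_injective (hg.trans (hcomp (e i)).symm)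
      rw [this, hf]
      exact (e i).2
  choose p hp using key
  have hinj : Function.Injective p := by
    intro D E hDE
    ext K
    rw [hp, hp, hDE]
  have := Fintype.card_le_of_injective p hinj
  simpa [Fintype.card_prod] using this

end Counting

/-! ### First moment: below the threshold -/

section Subcritical

variable {U W : Type*} [Fintype U] [Fintype W] [Nonempty W] {H : SimpleGraph W}
  {S : SimpleGraph U}

/-- Union bound over the sparse subfamilies forced by `S`. Vertex counts are integers, so `gammaBar
S H * d` may be replaced by its floor in the counting. -/
theorem real_isContained_le (hS : S ≠ ⊥) {n m : ℕ} (hn : 0 < n) (hm : m ≤ (copies H n).card) :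
    (uniformMotifGraph H n m).real {G | S ⊑ G} ≤
      ∑ d ∈ Finset.Icc 1 (Fintype.card U + Fintype.card U * Fintype.card U),
        ((⌊gammaBar S H * d⌋₊ : ℝ) ^ Fintype.card W) ^ d *
          ((n : ℝ) ^ gammaBar S H * ((m : ℝ) / (copies H n).card)) ^ d := by
  classical
  set g := gammaBar S H with hg
  have hg0 : 0 ≤ g := gammaBar_nonneg S H
  set X := copies H n with hX
  set L := Fintype.card U + Fintype.card U * Fintype.card U with hL
  set M : ℝ := ((X.card.choose m : ℕ) : ℝ) with hM
  have hMpos : 0 < M := Nat.cast_pos.2 (Nat.choose_pos hm)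
  set p : ℝ := (m : ℝ) / X.card with hp
  let 𝒟 : ℕ → Finset (Finset (⊤ : SimpleGraph (Fin n)).Subgraph) := fun d =>
    (X.powersetCard d).filter fun D : Finset (⊤ : SimpleGraph (Fin n)).Subgraph =>
      (sSup (D : Set (⊤ : SimpleGraph (Fin n)).Subgraph)).verts.ncard ≤ ⌊g * d⌋₊
  have hcount : ∀ d ∈ Finset.Icc 1 L, ((𝒟 d).card : ℝ) ≤
      ((⌊g * d⌋₊ : ℝ) ^ Fintype.card W) ^ d * ((n : ℝ) ^ g) ^ d := by
    intro d hd
    have h1 : (𝒟 d).card ≤ n ^ ⌊g * d⌋₊ * (⌊g * d⌋₊ ^ Fintype.card W) ^ d := by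
      refine card_families_le H (by have := (Finset.mem_Icc.1 hd).1; omega) _ fun D hD => ?_
      simp only [𝒟, Finset.mem_filter, Finset.mem_powersetCard] at hD
      exact ⟨hD.1.2, fun K hK => mem_copies.1 (hD.1.1 hK), hD.2⟩
    have h2 : (n : ℝ) ^ ⌊g * d⌋₊ ≤ ((n : ℝ) ^ g) ^ d := by
      rw [← Real.rpow_natCast, ← Real.rpow_mul_natCast (by positivity)]
      exact Real.rpow_le_rpow_of_exponent_le (by exact_mod_cast hn)
        (Nat.floor_le (by positivity))
    calc ((𝒟 d).card : ℝ) ≤ (n : ℝ) ^ ⌊g * d⌋₊ * ((⌊g * d⌋₊ : ℝ) ^ Fintype.card W) ^ d := by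
          exact_mod_cast h1
      _ ≤ ((n : ℝ) ^ g) ^ d * ((⌊g * d⌋₊ : ℝ) ^ Fintype.card W) ^ d := by gcongr
      _ = _ := mul_comm _ _
  rw [uniformMotifGraph_real, div_le_iff₀ hMpos]
  have hsub : ((X.powersetCard m).filter fun F : Finset (⊤ : SimpleGraph (Fin n)).Subgraph =>
        S ⊑ (sSup (F : Set (⊤ : SimpleGraph (Fin n)).Subgraph)).spanningCoe) ⊆
      (Finset.Icc 1 L).biUnion fun d => (𝒟 d).biUnion fun D =>
        (X.powersetCard m).filter (D ⊆ ·) := by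
    intro F hF
    rw [Finset.mem_filter] at hF
    have hFX := (Finset.mem_powersetCard.1 hF.1).1
    obtain ⟨D, hDF, hDne, hDL, hDg⟩ := exists_sparse_subfamily (H := H) hS
      (fun K hK => mem_copies.1 (hFX (Finset.mem_coe.1 hK))) hF.2
    obtain ⟨D, rfl⟩ : ∃ E : Finset (⊤ : SimpleGraph (Fin n)).Subgraph, (E : Set _) = D :=
      ⟨D.toFinite.toFinset, by simp⟩
    rw [Set.ncard_coe_finset] at hDL hDg
    have hDF' : D ⊆ F := Finset.coe_subset.1 hDF
    simp only [Finset.mem_biUnion, Finset.mem_Icc, 𝒟, Finset.mem_filter, Finset.mem_powersetCard]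
    exact ⟨D.card, ⟨Finset.card_pos.2 (Finset.coe_nonempty.1 hDne), hDL⟩, D,
      ⟨⟨hDF'.trans hFX, rfl⟩, Nat.le_floor hDg⟩, Finset.mem_powersetCard.1 hF.1, hDF'⟩
  have hcard := (Finset.card_le_card hsub).trans (Finset.card_biUnion_le.trans
    (Finset.sum_le_sum fun d _ => Finset.card_biUnion_le))
  have hcard' : (((X.powersetCard m).filter fun F : Finset (⊤ : SimpleGraph (Fin n)).Subgraph =>
        S ⊑ (sSup (F : Set (⊤ : SimpleGraph (Fin n)).Subgraph)).spanningCoe).card : ℝ) ≤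
      ∑ d ∈ Finset.Icc 1 L, ∑ D ∈ 𝒟 d, (((X.powersetCard m).filter (D ⊆ ·)).card : ℝ) := by
    exact_mod_cast hcard
  refine hcard'.trans ?_
  rw [Finset.sum_mul]
  refine Finset.sum_le_sum fun d hd => ?_
  calc ∑ D ∈ 𝒟 d, (((X.powersetCard m).filter (D ⊆ ·)).card : ℝ)
      ≤ ∑ D ∈ 𝒟 d, p ^ d * M := by
        refine Finset.sum_le_sum fun D hD => ?_
        simp only [𝒟, Finset.mem_filter, Finset.mem_powersetCard] at hD
        rw [card_filter_subset_powersetCard hD.1.1 hm, hD.1.2]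
        exact mul_le_mul_of_nonneg_right (inclusionProb_le_pow hm d) hMpos.le
    _ = (𝒟 d).card * (p ^ d * M) := by rw [Finset.sum_const, nsmul_eq_mul]
    _ ≤ ((⌊g * d⌋₊ : ℝ) ^ Fintype.card W) ^ d * ((n : ℝ) ^ g) ^ d * (p ^ d * M) :=
        mul_le_mul_of_nonneg_right (hcount d hd) (by positivity)
    _ = _ := by rw [mul_pow]; ring

theorem tendsto_zero (hS : S ≠ ⊥) {m : ℕ → ℕ} (hm : ∀ᶠ n in atTop, m n ≤ (copies H n).card)
    (h : (fun n => (m n : ℝ)) =o[atTop]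
      fun n : ℕ => (n : ℝ) ^ ((Fintype.card W : ℝ) - gammaBar S H)) :
    Tendsto (fun n => (uniformMotifGraph H n (m n)).real {G | S ⊑ G}) atTop (𝓝 0) := by
  set g := gammaBar S H with hg
  set v := Fintype.card W with hv
  have hratio : Tendsto (fun n : ℕ => (n : ℝ) ^ g * ((m n : ℝ) / (copies H n).card)) atTop
      (𝓝 0) := by
    have h1 := (h.tendsto_div_nhds_zero).const_mul (2 ^ v * (v.factorial : ℝ))
    rw [mul_zero] at h1
    refine squeeze_zero' (Eventually.of_forall fun n => by positivity) ?_ h1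
    filter_upwards [eventually_ge_atTop (2 * v), eventually_gt_atTop 0] with n hn hn0
    have hn0' : (0 : ℝ) < n := by exact_mod_cast hn0
    have h2 := pow_le_card_copies H hn
    rw [Real.rpow_sub hn0', Real.rpow_natCast]
    calc (n : ℝ) ^ g * ((m n : ℝ) / (copies H n).card)
        ≤ (n : ℝ) ^ g * ((m n : ℝ) / ((n : ℝ) ^ v / (2 ^ v * v.factorial))) := by
          gcongr
      _ = _ := by
          have : (0 : ℝ) < (n : ℝ) ^ g := Real.rpow_pos_of_pos hn0' g
          field_simp
  have hsum : Tendsto (fun n : ℕ =>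
      ∑ d ∈ Finset.Icc 1 (Fintype.card U + Fintype.card U * Fintype.card U),
        ((⌊g * d⌋₊ : ℝ) ^ v) ^ d * ((n : ℝ) ^ g * ((m n : ℝ) / (copies H n).card)) ^ d)
      atTop (𝓝 0) := by
    rw [← Finset.sum_const_zero (s := Finset.Icc 1
      (Fintype.card U + Fintype.card U * Fintype.card U))]
    refine tendsto_finsetSum _ fun d hd => ?_
    have hd0 : d ≠ 0 := by have := (Finset.mem_Icc.1 hd).1; omega
    simpa [hd0] using (hratio.pow d).const_mul (((⌊g * d⌋₊ : ℝ) ^ v) ^ d)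
  refine squeeze_zero' (Eventually.of_forall fun n => MeasureTheory.measureReal_nonneg) ?_ hsum
  filter_upwards [hm, eventually_gt_atTop 0] with n hn hn0
  exact real_isContained_le hS hn0 hn

end Subcritical

/-! ### Second moment: above the threshold -/

section Supercritical

variable {U W : Type*} {H : SimpleGraph W} {S : SimpleGraph U}

/-- An optimal covering, realized on a finite vertex set. -/
theorem exists_optimal_covering [Fintype U] [Fintype W] [Nonempty W]
    (hH : ∀ w, ¬ H.IsIsolated w) (hS : S ≠ ⊥) :
    ∃ (c : ℕ) (T : (⊤ : SimpleGraph (Fin c)).Subgraph)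
      (C : Finset (⊤ : SimpleGraph (Fin c)).Subgraph),
      IsCopy S T ∧ IsCovering H T (C : Set (⊤ : SimpleGraph (Fin c)).Subgraph) ∧
        gammaBar S H = gamma (C : Set (⊤ : SimpleGraph (Fin c)).Subgraph) := by
  obtain ⟨T, hT, C, hC, hgam⟩ := exists_gamma_eq_gammaBar (H := H) hH hS
  have hfin := finite_verts_sSup hC.finite hC.isCopy
  obtain ⟨A, hA⟩ : ∃ A, A = (sSup C).verts := ⟨_, rfl⟩
  rw [← hA] at hfin
  have : Finite A := hfin
  let ι : Fin (Nat.card A) ↪ ℕ :=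
    (Finite.equivFin A).symm.toEmbedding.trans (Function.Embedding.subtype _)
  have hι : ∀ x ∈ A, x ∈ Set.range ι := fun x hx =>
    ⟨Finite.equivFin A ⟨x, hx⟩,
      congrArg Subtype.val ((Finite.equivFin A).symm_apply_apply ⟨x, hx⟩)⟩
  obtain ⟨T, rfl⟩ := exists_relabel_eq ι fun x hx => hι x (hA ▸ hC.covers.1 hx)
  have hCι : C ⊆ Set.range (relabel ι) := fun K hK =>
    exists_relabel_eq ι fun x hx => hι x (hA ▸ (le_sSup hK).1 hx)
  obtain ⟨C, rfl⟩ := Set.subset_range_iff_exists_image_eq.1 hCι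
  have hCfin : C.Finite := Set.toFinite C
  refine ⟨_, T, hCfin.toFinset, (isCopy_relabel ι).1 hT, ?_, ?_⟩
  · rw [Set.Finite.coe_toFinset]
    refine ⟨hCfin, fun K hK => (isCopy_relabel ι).1 (hC.isCopy _ ⟨K, hK, rfl⟩), ?_, ?_⟩
    · rw [← relabel_le_relabel ι, relabel_sSup]
      exact hC.covers
    · intro K hK hle
      refine hC.minimal _ ⟨K, hK, rfl⟩ ?_
      rwa [← Set.image_singleton, ← Set.image_sdiff (relabel_injective ι), ← relabel_sSup,
        relabel_le_relabel]
  · rw [Set.Finite.coe_toFinset, hgam, gamma_relabel]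

open Classical in
theorem card_embeddings_le {c n : ℕ} (B : Finset (Fin c)) (R : Finset (Fin n)) :
    ((Finset.univ : Finset (Fin c ↪ Fin n)).filter fun g => ∀ x ∈ B, g x ∈ R).card ≤
      R.card ^ B.card * n ^ (c - B.card) := by
  have hcard : (Fintype.piFinset fun x => if x ∈ B then R else Finset.univ).card =
      R.card ^ B.card * n ^ (c - B.card) := by
    rw [Fintype.card_piFinset]
    simp only [apply_ite Finset.card, Finset.card_univ, Fintype.card_fin]
    rw [Finset.prod_ite, Finset.prod_const, Finset.prod_const, Finset.filter_mem_eq_inter,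
      Finset.univ_inter, Finset.filter_not, Finset.filter_mem_eq_inter, Finset.univ_inter,
      Finset.card_univ_sdiff, Fintype.card_fin]
  rw [← hcard]
  refine Finset.card_le_card_of_injOn (fun g => ⇑g) ?_ DFunLike.coe_injective.injOn
  intro g hg
  simp only [Finset.coe_filter, Finset.mem_univ, true_and] at hg
  simp only [Finset.mem_coe, Fintype.mem_piFinset]
  intro x
  split_ifs with hx
  · exact hg x hx
  · exact Finset.mem_univ _

open Classical in
-- Pairs of intersecting images are sorted by the set `D` of members of `C` whose second image is
-- also a first image. The first injection has at most `n ^ c` choices; the second must send the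
-- vertices of `D` into the `c` points used by the first and is free elsewhere. The two images
-- together have `2 * C.card - D.card` copies.
theorem sum_inclusionProb_le {c n m N : ℕ} (hm : m ≤ N)
    (C : Finset (⊤ : SimpleGraph (Fin c)).Subgraph) :
    ∑ p ∈ ((Finset.univ : Finset (Fin c ↪ Fin n)) ×ˢ Finset.univ).filter
        (fun p => ¬ Disjoint (C.image (relabel p.1)) (C.image (relabel p.2))),
      inclusionProb N m (C.image (relabel p.1) ∪ C.image (relabel p.2)).card ≤
    ∑ D ∈ C.powerset.filter (·.Nonempty),
      (n : ℝ) ^ c * ((c : ℝ) ^ (sSup (D : Set (⊤ : SimpleGraph (Fin c)).Subgraph)).verts.ncard *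
        (n : ℝ) ^ (c - (sSup (D : Set (⊤ : SimpleGraph (Fin c)).Subgraph)).verts.ncard)) *
        ((m : ℝ) / N) ^ (2 * C.card - D.card) := by
  set I := ((Finset.univ : Finset (Fin c ↪ Fin n)) ×ˢ Finset.univ).filter
        (fun p => ¬ Disjoint (C.image (relabel p.1)) (C.image (relabel p.2))) with hI
  let τ : (Fin c ↪ Fin n) × (Fin c ↪ Fin n) → Finset (⊤ : SimpleGraph (Fin c)).Subgraph :=
    fun p => C.filter fun K => relabel p.2 K ∈ C.image (relabel p.1)
  have hτcard : ∀ p, (C.image (relabel p.1) ∩ C.image (relabel p.2)).card = (τ p).card := by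
    intro p
    rw [← Finset.card_image_of_injective (τ p) (relabel_injective p.2)]
    congr 1
    ext K
    simp only [Finset.mem_inter, τ, Finset.mem_image, Finset.mem_filter]
    constructor
    · rintro ⟨h1, K, hK, rfl⟩
      exact ⟨K, ⟨hK, h1⟩, rfl⟩
    · rintro ⟨K, ⟨hK, h1⟩, rfl⟩
      exact ⟨h1, K, hK, rfl⟩
  have hmaps : ∀ p ∈ I, τ p ∈ C.powerset.filter (·.Nonempty) := by
    intro p hp
    rw [hI, Finset.mem_filter, Finset.disjoint_iff_inter_eq_empty, ← Finset.card_eq_zero,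
      hτcard] at hp
    rw [Finset.mem_filter, Finset.mem_powerset]
    exact ⟨Finset.filter_subset _ _, Finset.card_pos.1 (Nat.pos_of_ne_zero hp.2)⟩
  rw [← Finset.sum_fiberwise_of_maps_to hmaps]
  refine Finset.sum_le_sum fun D _ => ?_
  set B : Set (Fin c) := (sSup (D : Set (⊤ : SimpleGraph (Fin c)).Subgraph)).verts with hB
  have hterm : ∀ p ∈ I.filter (fun p => τ p = D),
      inclusionProb N m (C.image (relabel p.1) ∪ C.image (relabel p.2)).card ≤
        ((m : ℝ) / N) ^ (2 * C.card - D.card) := by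
    intro p hp
    rw [Finset.mem_filter] at hp
    have : (C.image (relabel p.1) ∪ C.image (relabel p.2)).card = 2 * C.card - D.card := by
      have h1 := Finset.card_union_add_card_inter (C.image (relabel p.1)) (C.image (relabel p.2))
      rw [hτcard, hp.2, Finset.card_image_of_injective _ (relabel_injective _),
        Finset.card_image_of_injective _ (relabel_injective _)] at h1
      omega
    rw [this]
    exact inclusionProb_le_pow hm _
  have hcount : (I.filter fun p => τ p = D).card ≤
      n ^ c * (c ^ B.ncard * n ^ (c - B.ncard)) := by
    have hsub : (I.filter fun p => τ p = D) ⊆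
        ((Finset.univ : Finset (Fin c ↪ Fin n)).biUnion fun f =>
          ({f} : Finset (Fin c ↪ Fin n)) ×ˢ
          (Finset.univ : Finset (Fin c ↪ Fin n)).filter fun g =>
            ∀ x ∈ B.toFinset, g x ∈ Finset.univ.image f) := by
      rintro ⟨f, g⟩ hp
      have hp := (Finset.mem_filter.1 hp).2
      simp only [Finset.mem_biUnion, Finset.mem_univ, true_and, Finset.mem_product,
        Finset.mem_singleton, Finset.mem_filter]
      refine ⟨f, rfl, fun x hx => ?_⟩
      rw [Set.mem_toFinset, hB, SimpleGraph.Subgraph.verts_sSup] at hx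
      simp only [Set.mem_iUnion, exists_prop, Finset.mem_coe] at hx
      obtain ⟨K, hK, hx⟩ := hx
      rw [← hp] at hK
      obtain ⟨L, -, hL⟩ := Finset.mem_image.1 (Finset.mem_filter.1 hK).2
      have hgx : g x ∈ (relabel g K).verts := ⟨x, hx, rfl⟩
      dsimp only at hL
      rw [← hL] at hgx
      obtain ⟨y, -, hy⟩ := hgx
      exact Finset.mem_image.2 ⟨y, Finset.mem_univ _, hy⟩
    refine (Finset.card_le_card hsub).trans (Finset.card_biUnion_le.trans ?_)
    have hle : ∀ f ∈ (Finset.univ : Finset (Fin c ↪ Fin n)),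
        (({f} : Finset (Fin c ↪ Fin n)) ×ˢ
          (Finset.univ : Finset (Fin c ↪ Fin n)).filter fun g =>
            ∀ x ∈ B.toFinset, g x ∈ Finset.univ.image f).card ≤
          c ^ B.ncard * n ^ (c - B.ncard) := by
      intro f _
      rw [Finset.card_product, Finset.card_singleton, one_mul]
      refine (card_embeddings_le _ _).trans (le_of_eq ?_)
      rw [Finset.card_image_of_injective _ f.injective, Finset.card_univ, Fintype.card_fin,
        Set.ncard_eq_toFinset_card' B]
    refine (Finset.sum_le_card_nsmul _ _ _ hle).trans ?_
    rw [smul_eq_mul, Finset.card_univ, Fintype.card_embedding_eq, Fintype.card_fin,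
      Fintype.card_fin]
    exact Nat.mul_le_mul_right _ (Nat.descFactorial_le_pow n c)
  refine (Finset.sum_le_card_nsmul _ _ _ hterm).trans ?_
  rw [nsmul_eq_mul]
  refine mul_le_mul_of_nonneg_right ?_ (by positivity)
  exact_mod_cast hcount

/-- Here `E` is a number of injections and `q` an inclusion probability, so `E * q` is a mean of
order at least $n^cp^k$. Dividing the overlap term by its square leaves a constant times
$(n^ap^d)^{-1}$, and $a\ge gd$ together with $p\ge m/n^v$ turns this into a power of $n^{v-g}/m$.
The factor `2 ^ (2 * c + 2 * k)` pays for the halvings in `hE` and `hq`. -/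
theorem ratio_le {c n m N k a d v : ℕ} {g q E : ℝ} (hn : 0 < n) (hm : 0 < m) (hN : 0 < N)
    (hNn : N ≤ n ^ v) (hac : a ≤ c) (hdk : d ≤ k) (hga : g * d ≤ a)
    (hE : ((n : ℝ) / 2) ^ c ≤ E) (hq : ((m : ℝ) / N / 2) ^ k ≤ q) :
    (n : ℝ) ^ c * ((c : ℝ) ^ a * (n : ℝ) ^ (c - a)) * ((m : ℝ) / N) ^ (2 * k - d) ≤
      ((c : ℝ) ^ a * 2 ^ (2 * c + 2 * k) * ((n : ℝ) ^ ((v : ℝ) - g) / m) ^ d) * (E * q) ^ 2 := by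
  have hn' : (0 : ℝ) < n := by exact_mod_cast hn
  have hm' : (0 : ℝ) < m := by exact_mod_cast hm
  have hN' : (0 : ℝ) < N := by exact_mod_cast hN
  set p : ℝ := (m : ℝ) / N with hp
  have hp0 : 0 < p := by positivity
  set y : ℝ := (n : ℝ) ^ ((v : ℝ) - g) / m with hy
  have hy0 : 0 < y := div_pos (Real.rpow_pos_of_pos hn' _) hm'
  have hkey : 1 ≤ y ^ d * ((n : ℝ) ^ a * p ^ d) := by
    have h1 : (n : ℝ) ^ (g * d) ≤ (n : ℝ) ^ a := by
      rw [← Real.rpow_natCast (n : ℝ) a]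
      exact Real.rpow_le_rpow_of_exponent_le (by exact_mod_cast hn) hga
    have h2 : (m : ℝ) / (n : ℝ) ^ v ≤ p :=
      div_le_div_of_nonneg_left hm'.le hN' (by exact_mod_cast hNn)
    have h3 : y * ((n : ℝ) ^ g * ((m : ℝ) / (n : ℝ) ^ v)) = 1 := by
      rw [hy, Real.rpow_sub hn', Real.rpow_natCast]
      have : (0 : ℝ) < (n : ℝ) ^ g := Real.rpow_pos_of_pos hn' g
      field_simp
    calc (1 : ℝ) = (y * ((n : ℝ) ^ g * ((m : ℝ) / (n : ℝ) ^ v))) ^ d := by rw [h3, one_pow]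
      _ = y ^ d * ((n : ℝ) ^ (g * d) * ((m : ℝ) / (n : ℝ) ^ v) ^ d) := by
          rw [mul_pow, mul_pow, ← Real.rpow_mul_natCast hn'.le]
      _ ≤ y ^ d * ((n : ℝ) ^ a * p ^ d) := by gcongr
  have hE0 : 0 ≤ E := le_trans (by positivity) hE
  have hEq : (((n : ℝ) / 2) ^ c * (p / 2) ^ k) ^ 2 ≤ (E * q) ^ 2 := by gcongr
  have hsplit : (((n : ℝ) / 2) ^ c * (p / 2) ^ k) ^ 2 * 2 ^ (2 * c + 2 * k) =
      (n : ℝ) ^ c * (n : ℝ) ^ (c - a) * p ^ (2 * k - d) * ((n : ℝ) ^ a * p ^ d) := by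
    have h1 : (n : ℝ) ^ (c - a) * (n : ℝ) ^ a = (n : ℝ) ^ c := by
      rw [← pow_add, Nat.sub_add_cancel hac]
    have h2 : p ^ (2 * k - d) * p ^ d = p ^ (2 * k) := by
      rw [← pow_add, Nat.sub_add_cancel (by omega)]
    calc (((n : ℝ) / 2) ^ c * (p / 2) ^ k) ^ 2 * 2 ^ (2 * c + 2 * k)
        = (n : ℝ) ^ c * (n : ℝ) ^ c * p ^ (2 * k) := by
          rw [div_pow, div_pow, pow_add, pow_mul', pow_mul', pow_mul']
          field_simp
      _ = _ := by rw [← h2]; nth_rewrite 2 [← h1]; ring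
  calc (n : ℝ) ^ c * ((c : ℝ) ^ a * (n : ℝ) ^ (c - a)) * p ^ (2 * k - d)
      = (c : ℝ) ^ a * ((n : ℝ) ^ c * (n : ℝ) ^ (c - a) * p ^ (2 * k - d)) * 1 := by ring
    _ ≤ (c : ℝ) ^ a * ((n : ℝ) ^ c * (n : ℝ) ^ (c - a) * p ^ (2 * k - d)) *
        (y ^ d * ((n : ℝ) ^ a * p ^ d)) := by gcongr
    _ = (c : ℝ) ^ a * 2 ^ (2 * c + 2 * k) * y ^ d * (((n : ℝ) / 2) ^ c * (p / 2) ^ k) ^ 2 := by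
        linear_combination (-(c : ℝ) ^ a * y ^ d) * hsplit
    _ ≤ _ := by gcongr

open Classical in
/-- The families whose union avoids `S` contain no relabelled copy of a covering of `S`. -/
theorem exists_not_subset_family {c n m : ℕ}
    {T : (⊤ : SimpleGraph (Fin c)).Subgraph} {C : Finset (⊤ : SimpleGraph (Fin c)).Subgraph}
    (hT : IsCopy S T) (hC : T ≤ sSup (C : Set (⊤ : SimpleGraph (Fin c)).Subgraph))
    (hm : m ≤ (copies H n).card) :
    ∃ B ⊆ (copies H n).powersetCard m,
      (∀ F ∈ B, ∀ f : Fin c ↪ Fin n, ¬ C.image (relabel f) ⊆ F) ∧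
      1 - (uniformMotifGraph H n m).real {G | S ⊑ G} ≤
        B.card / ((copies H n).card.choose m : ℕ) := by
  set X := copies H n with hX
  have hMpos : (0 : ℝ) < ((X.card.choose m : ℕ) : ℝ) := Nat.cast_pos.2 (Nat.choose_pos hm)
  refine ⟨(X.powersetCard m).filter fun F : Finset (⊤ : SimpleGraph (Fin n)).Subgraph =>
    ¬ S ⊑ (sSup (F : Set (⊤ : SimpleGraph (Fin n)).Subgraph)).spanningCoe,
    Finset.filter_subset _ _, fun F hF f hfF => (Finset.mem_filter.1 hF).2 ?_, ?_⟩
  · refine ((isCopy_relabel f).2 hT).isContained_spanningCoe ?_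
    refine ((relabel_le_relabel f).2 hC).trans ?_
    rw [relabel_sSup]
    refine sSup_le_sSup ?_
    rintro _ ⟨K, hK, rfl⟩
    exact hfF (Finset.mem_image_of_mem _ hK)
  · rw [uniformMotifGraph_real, ← hX, sub_le_iff_le_add, ← add_div, le_div_iff₀ hMpos, one_mul]
    have hsplit := Finset.card_filter_add_card_filter_not (s := X.powersetCard m)
      fun F : Finset (⊤ : SimpleGraph (Fin n)).Subgraph =>
        S ⊑ (sSup (F : Set (⊤ : SimpleGraph (Fin n)).Subgraph)).spanningCoe
    rw [Finset.card_powersetCard, add_comm] at hsplit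
    exact_mod_cast hsplit.ge

open Classical in
theorem one_sub_real_isContained_le [Fintype W] {c n m : ℕ}
    {T : (⊤ : SimpleGraph (Fin c)).Subgraph} {C : Finset (⊤ : SimpleGraph (Fin c)).Subgraph}
    (hT : IsCopy S T) (hC : IsCovering H T (C : Set (⊤ : SimpleGraph (Fin c)).Subgraph)) (hn : 0 < n)
    (hcn : 2 * c ≤ n) (hm0 : 0 < m) (hkm : 2 * C.card ≤ m) (hm : m ≤ (copies H n).card) :
    1 - (uniformMotifGraph H n m).real {G | S ⊑ G} ≤
      ∑ D ∈ C.powerset.filter (·.Nonempty),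
        ((c : ℝ) ^ (sSup (D : Set (⊤ : SimpleGraph (Fin c)).Subgraph)).verts.ncard *
          2 ^ (2 * c + 2 * C.card) *
          ((n : ℝ) ^ ((Fintype.card W : ℝ) -
            gamma (C : Set (⊤ : SimpleGraph (Fin c)).Subgraph)) / m) ^ D.card) := by
  set X := copies H n with hX
  set M : ℝ := ((X.card.choose m : ℕ) : ℝ) with hM
  have hMpos : 0 < M := Nat.cast_pos.2 (Nat.choose_pos hm)
  have hn' : (0 : ℝ) < n := by exact_mod_cast hn
  have hm0' : (0 : ℝ) < m := by exact_mod_cast hm0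
  have hN0 : 0 < X.card := hm0.trans_le hm
  let I : Finset (Fin c ↪ Fin n) := Finset.univ
  let φ : (Fin c ↪ Fin n) → Finset (⊤ : SimpleGraph (Fin n)).Subgraph := fun f =>
    C.image (relabel f)
  have hφX : ∀ f ∈ I, φ f ⊆ X := by
    intro f _ K hK
    obtain ⟨L, hL, rfl⟩ := Finset.mem_image.1 hK
    exact mem_copies.2 ((isCopy_relabel f).2 (hC.isCopy L hL))
  have hφcard : ∀ f ∈ I, (φ f).card = C.card := fun f _ =>
    Finset.card_image_of_injective _ (relabel_injective f)
  obtain ⟨B, hBX, hB, hcompl⟩ := exists_not_subset_family hT hC.covers hm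
  refine hcompl.trans ?_
  rw [div_le_iff₀ hMpos]
  set E : ℝ := (I.card : ℝ) with hE
  set q : ℝ := inclusionProb X.card m C.card with hq
  have hEle : ((n : ℝ) / 2) ^ c ≤ E := by
    have h1 : (n + 1 - c) ^ c ≤ I.card := by
      simp only [I, Finset.card_univ, Fintype.card_embedding_eq, Fintype.card_fin]
      exact Nat.pow_sub_le_descFactorial n c
    have h2 : ((n + 1 - c : ℕ) : ℝ) ^ c ≤ E := by
      rw [hE]
      exact_mod_cast h1
    refine le_trans ?_ h2
    gcongr
    have : (n : ℝ) ≤ 2 * ((n + 1 - c : ℕ) : ℝ) := by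
      exact_mod_cast (by omega : n ≤ 2 * (n + 1 - c))
    linarith
  have hqle : ((m : ℝ) / X.card / 2) ^ C.card ≤ q := pow_le_inclusionProb hm hkm
  have hN0' : (0 : ℝ) < X.card := by exact_mod_cast hN0
  have hE0 : 0 < E := lt_of_lt_of_le (by positivity) hEle
  have hq0 : 0 < q := lt_of_lt_of_le (by positivity) hqle
  have hpos : 0 < (E * q) ^ 2 := by positivity
  have hsum := sum_inclusionProb_le (n := n) hm C
  generalize hR : (∑ D ∈ C.powerset.filter (·.Nonempty), _ : ℝ) = R at hsum
  have hle : B.card * (E * q) ^ 2 ≤ M * R := by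
    refine (card_forall_not_subset_le hm I φ hφX hφcard hBX (fun F hF f _ => hB F hF f)
      fun f _ g _ hfg => ?_).trans (mul_le_mul_of_nonneg_left hsum hMpos.le)
    exact Finset.mem_filter.2 ⟨Finset.mem_product.2 ⟨Finset.mem_univ _, Finset.mem_univ _⟩, hfg⟩
  refine le_of_mul_le_mul_right (hle.trans ?_) hpos
  rw [mul_comm, mul_right_comm]
  refine mul_le_mul_of_nonneg_right ?_ hMpos.le
  rw [← hR]
  rw [Finset.sum_mul]
  refine Finset.sum_le_sum fun D hD => ?_
  rw [Finset.mem_filter, Finset.mem_powerset] at hD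
  refine ratio_le hn hm0 hN0 (card_copies_le H n) ?_ (Finset.card_le_card hD.1) ?_ hEle hqle
  · simpa using Set.ncard_le_ncard
      (Set.subset_univ (sSup (D : Set (⊤ : SimpleGraph (Fin c)).Subgraph)).verts)
  · have := gamma_mul_ncard_le (C := (C : Set (⊤ : SimpleGraph (Fin c)).Subgraph))
      (D := (D : Set (⊤ : SimpleGraph (Fin c)).Subgraph)) C.finite_toSet
      (Finset.coe_subset.2 hD.1) (Finset.coe_nonempty.2 hD.2)
    rwa [Set.ncard_coe_finset] at this

theorem tendsto_one [Fintype U] [Fintype W] [Nonempty W] (hH : ∀ w, ¬ H.IsIsolated w)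
    (hS : S ≠ ⊥) {m : ℕ → ℕ} (hm : ∀ᶠ n in atTop, m n ≤ (copies H n).card)
    (h : (fun n : ℕ => (n : ℝ) ^ ((Fintype.card W : ℝ) - gammaBar S H)) =o[atTop]
      fun n => (m n : ℝ)) :
    Tendsto (fun n => (uniformMotifGraph H n (m n)).real {G | S ⊑ G}) atTop (𝓝 1) := by
  classical
  obtain ⟨c, T, C, hT, hC, hgam⟩ := exists_optimal_covering hH hS
  have hratio := h.tendsto_div_nhds_zero
  -- Since `gammaBar S H ≤ Fintype.card W`, the threshold is at least `1`, so `m` tends to infinity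
  -- and eventually exceeds `2 * C.card`, as the lower bound on inclusion probabilities requires.
  have hmtop : ∀ k : ℕ, ∀ᶠ n in atTop, k ≤ m n := by
    intro k
    have hk : (0 : ℝ) < 1 / (k + 1) := by positivity
    filter_upwards [h.bound hk, eventually_gt_atTop 0] with n hn hn0
    have h1 : (1 : ℝ) ≤ (n : ℝ) ^ ((Fintype.card W : ℝ) - gammaBar S H) := by
      refine Real.one_le_rpow (by exact_mod_cast hn0) (sub_nonneg.2 ?_)
      simpa using gammaBar_le_card (H := H) hS
    rw [Real.norm_of_nonneg (zero_le_one.trans h1), Real.norm_of_nonneg (by positivity),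
      one_div, ← div_eq_inv_mul] at hn
    have h2 := (le_div_iff₀ (by positivity)).1 (h1.trans hn)
    have h3 : (k : ℝ) ≤ m n := by linarith
    exact_mod_cast h3
  have hsum : Tendsto (fun n : ℕ => ∑ D ∈ C.powerset.filter (·.Nonempty),
      ((c : ℝ) ^ (sSup (D : Set (⊤ : SimpleGraph (Fin c)).Subgraph)).verts.ncard *
        2 ^ (2 * c + 2 * C.card) *
        ((n : ℝ) ^ ((Fintype.card W : ℝ) -
          gamma (C : Set (⊤ : SimpleGraph (Fin c)).Subgraph)) / m n) ^ D.card)) atTop (𝓝 0) := by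
    suffices h0 : ∀ D ∈ C.powerset.filter (·.Nonempty), Tendsto (fun n : ℕ =>
        (c : ℝ) ^ (sSup (D : Set (⊤ : SimpleGraph (Fin c)).Subgraph)).verts.ncard *
          2 ^ (2 * c + 2 * C.card) *
          ((n : ℝ) ^ ((Fintype.card W : ℝ) -
            gamma (C : Set (⊤ : SimpleGraph (Fin c)).Subgraph)) / m n) ^ D.card)
        atTop (𝓝 0) by
      simpa only [Finset.sum_const_zero] using tendsto_finsetSum _ h0
    intro D hD
    have hD0 : D.card ≠ 0 := (Finset.card_pos.2 (Finset.mem_filter.1 hD).2).ne'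
    rw [hgam] at hratio
    have := (hratio.pow D.card).const_mul
      ((c : ℝ) ^ (sSup (D : Set (⊤ : SimpleGraph (Fin c)).Subgraph)).verts.ncard *
        2 ^ (2 * c + 2 * C.card))
    rwa [zero_pow hD0, mul_zero] at this
  have hone : Tendsto (fun n => 1 - (uniformMotifGraph H n (m n)).real {G | S ⊑ G}) atTop
      (𝓝 0) := by
    refine squeeze_zero' ?_ ?_ hsum
    · filter_upwards [hm] with n hn
      rw [sub_nonneg, uniformMotifGraph_real]
      refine div_le_one_of_le₀ ?_ (by positivity)
      rw [← Finset.card_powersetCard]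
      exact_mod_cast Finset.card_filter_le _ _
    · filter_upwards [hm, hmtop 1, hmtop (2 * C.card), eventually_gt_atTop 0,
        eventually_ge_atTop (2 * c)] with n h1 h2 h3 h4 h5
      exact one_sub_real_isContained_le hT hC h4 h5 h2 h3 h1
  simpa using hone.const_sub 1

end Supercritical

end MotifGraph

theorem theorem8 {U W : Type*} [Fintype U] [Fintype W] [Nonempty W]
    (H : SimpleGraph W) (hH : ∀ w, ¬ H.IsIsolated w)
    (S : SimpleGraph U) (hS : S ≠ ⊥)
    (m : ℕ → ℕ)
    (hm : ∀ᶠ n in atTop, m n ≤ (⊤ : SimpleGraph (Fin n)).copyCount H) :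
    ((fun n => (m n : ℝ)) =o[atTop]
        (fun n : ℕ => (n : ℝ) ^ ((Fintype.card W : ℝ) - MotifGraph.gammaBar S H)) →
      Tendsto (fun n => (MotifGraph.uniformMotifGraph H n (m n)).real {G | S ⊑ G})
        atTop (𝓝 0)) ∧
    ((fun n : ℕ => (n : ℝ) ^ ((Fintype.card W : ℝ) - MotifGraph.gammaBar S H)) =o[atTop]
        (fun n => (m n : ℝ)) →
      Tendsto (fun n => (MotifGraph.uniformMotifGraph H n (m n)).real {G | S ⊑ G})
        atTop (𝓝 1)) := by
  simp only [← MotifGraph.card_copies] at hm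
  exact ⟨MotifGraph.tendsto_zero hS hm, MotifGraph.tendsto_one hH hS hm⟩
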